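/- **Theorem 1.4.** Let $L$ be a finite first-order language without relation symbols (constants are $0$-ary function symbols) and let $K$ be any class of $L$-structures (for example, all $L$-structures, or all groups). Let $A$ be an $L$-structure such that - $A$ is *computable*: its domain is a computable subset of $\mathbb N$ and its basic operations are restrictions of computable functions; - $A$ is *Hopfian*: every surjective endomorphism of $A$ is an automorphism; - $A$ is *finitely presented in $K$*: $A\in K$, and there are a finite tuple $\bar a$ generating $A$ and a finite conjunction $\psi(\bar x)$ of atomic $L$-formulas (equations between terms) such that $A\models\psi(\bar a)$ and, whenever $B\in K$ and $B\models\psi(\bar b)$, there is a homomorphism $A\to B$ mapping $\bar a$ to $\bar b$. Then the following are equivalent: 1. $A$ has a computable $d$-$\Sigma_2$ Scott sentence; 2. $A$ has decidable weak Whitehead problem: for every $n$ and every $n$-tuple $\bar a$ generating $A$, the orbit $\{\alpha(\bar a):\alpha\in\mathrm{Aut}(A)\}$ is a computable subset of $A^n$. Here a formula of $\mathfrak L_{\omega_1,\omega}$ is computable $\Sigma_0$, equivalently computable $\Pi_0$, if it is finitary and quantifier-free. For $\alpha>0$, it is computable $\Sigma_\alpha$ (resp. $\Pi_\alpha$) if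 it is a computably enumerable disjunction (resp. conjunction) of formulas $\exists\bar y\,\psi(\bar x,\bar y)$ (resp. $\forall\bar y\,\psi(\bar x,\bar y)$) with $\psi$ computable $\Pi_\beta$ (resp. $\Sigma_\beta$) for some $\beta<\alpha$; an enumeration of formulas is an enumeration of indices for them. A computable $d$-$\Sigma_2$ sentence is a conjunction of a computable $\Sigma_2$ sentence and a computable $\Pi_2$ sentence, and a *Scott sentence* of $A$ is a sentence whose countable models are exactly the structures isomorphic to $A$. -/

import Mathlib

open FirstOrder

namespace CompScott

universe u v

/-! ### Infinitary formulas -/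

/-- The formulas of `L_{ω₁,ω}` with free variables among `x₀, …, x_{n-1}`. Quantifiers bind finite
tuples of variables, and the infinitary connectives range over sets of natural numbers. -/
inductive InfFormula (L : FirstOrder.Language.{u, v}) : ℕ → Type (max u v)
  | finitary {n : ℕ} (φ : L.Formula (Fin n)) : InfFormula L n
  | ex {n : ℕ} (m : ℕ) (ψ : InfFormula L (n + m)) : InfFormula L n
  | all {n : ℕ} (m : ℕ) (ψ : InfFormula L (n + m)) : InfFormula L n
  | bigOr {n : ℕ} (S : Set ℕ) (ψ : S → InfFormula L n) : InfFormula L n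
  | bigAnd {n : ℕ} (S : Set ℕ) (ψ : S → InfFormula L n) : InfFormula L n
  | conj {n : ℕ} (φ ψ : InfFormula L n) : InfFormula L n

/-- Satisfaction `M ⊨ φ(v)`. -/
def InfFormula.Realize {L : FirstOrder.Language.{u, v}} (M : Type) [L.Structure M] :
    {n : ℕ} → InfFormula L n → (Fin n → M) → Prop
  | _, .finitary φ, v => φ.Realize v
  | _, .ex m ψ, v => ∃ y : Fin m → M, ψ.Realize M (Fin.append v y)
  | _, .all m ψ, v => ∀ y : Fin m → M, ψ.Realize M (Fin.append v y)
  | _, .bigOr S ψ, v => ∃ k : S, (ψ k).Realize M v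
  | _, .bigAnd S ψ, v => ∀ k : S, (ψ k).Realize M v
  | _, .conj φ ψ, v => φ.Realize M v ∧ ψ.Realize M v

/-! ### Computable infinitary formulas -/

/-- The `e`-th computably enumerable set: the domain of the `e`-th partial computable function. -/
def W (e : ℕ) : Set ℕ :=
  {k | ((Denumerable.ofNat Nat.Partrec.Code e).eval k).Dom}

/-- Gödel number of a finitary formula, through Mathlib's encoding of formulas as strings
(function symbols are numbered by the given `Encodable` instance; there are no relation symbols). -/
noncomputable def formulaCode {L : FirstOrder.Language.{u, v}} [hL : L.IsAlgebraic]
    [Encodable (Σ l, L.Functions l)] {n : ℕ} (φ : L.Formula (Fin n)) : ℕ :=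
  letI : IsEmpty (Σ l, L.Relations l) := ⟨fun r => (hL r.1).false r.2⟩
  letI : Encodable (Σ l, L.Relations l) := IsEmpty.toEncodable
  Encodable.encode (FirstOrder.Language.BoundedFormula.listEncode φ)

/-- The two sides of the hierarchy. -/
inductive Side
  | sigma
  | pi

/-- A number `k` in the set listed by an index of a `Σ_α` or `Π_α` formula describes one disjunct
`∃ȳ ψ` (one conjunct `∀ȳ ψ`): `k` codes the triple (level of `ψ`, length of `ȳ`, index of `ψ`). This is the level. -/
def lvl (k : ℕ) : ℕ := k.unpair.1

/-- The length of the quantified tuple of variables. -/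
def len (k : ℕ) : ℕ := k.unpair.2.unpair.1

/-- The index of the formula under the quantifier. -/
def idx (k : ℕ) : ℕ := k.unpair.2.unpair.2

/-- `HasIndex .sigma α e φ` (resp. `HasIndex .pi α e φ`): `φ` is the computable `Σ_α` (resp. `Π_α`)
formula with index `e`, for a finite level `α`. At level `0` the formula is finitary and
quantifier-free. At a level `α > 0` it is the c.e. disjunction, over the set `W e`, of formulas
`∃ȳ ψ` with `ψ` computable `Π_β`, `β < α` (resp. the c.e. conjunction of formulas `∀ȳ ψ` with `ψ`
computable `Σ_β`, `β < α`). -/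
inductive HasIndex {L : FirstOrder.Language.{u, v}} [L.IsAlgebraic] [Encodable (Σ l, L.Functions l)] :
    Side → ℕ → ℕ → {n : ℕ} → InfFormula L n → Prop
  | qf (s : Side) {n : ℕ} (φ : L.Formula (Fin n))
      (hφ : FirstOrder.Language.BoundedFormula.IsQF φ) :
      HasIndex s 0 (formulaCode φ) (.finitary φ)
  | sigma {n α e : ℕ} (hα : 0 < α) (ψ : (k : W e) → InfFormula L (n + len k))
      (hlt : ∀ k : W e, lvl k < α) (h : ∀ k : W e, HasIndex .pi (lvl k) (idx k) (ψ k)) :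
      HasIndex .sigma α e (.bigOr (W e) fun k => .ex (len k) (ψ k))
  | pi {n α e : ℕ} (hα : 0 < α) (ψ : (k : W e) → InfFormula L (n + len k))
      (hlt : ∀ k : W e, lvl k < α) (h : ∀ k : W e, HasIndex .sigma (lvl k) (idx k) (ψ k)) :
      HasIndex .pi α e (.bigAnd (W e) fun k => .all (len k) (ψ k))

/-- `φ` is a computable `Σ_α` formula. -/
def IsComputableSigma {L : FirstOrder.Language.{u, v}} [L.IsAlgebraic] [Encodable (Σ l, L.Functions l)]
    (α : ℕ) {n : ℕ} (φ : InfFormula L n) : Prop :=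
  ∃ e, HasIndex .sigma α e φ

/-- `φ` is a computable `Π_α` formula. -/
def IsComputablePi {L : FirstOrder.Language.{u, v}} [L.IsAlgebraic] [Encodable (Σ l, L.Functions l)]
    (α : ℕ) {n : ℕ} (φ : InfFormula L n) : Prop :=
  ∃ e, HasIndex .pi α e φ

/-- `φ` is a computable `d-Σ_α` formula: the conjunction of a computable `Σ_α` formula and a
computable `Π_α` formula. -/
def IsComputableDSigma {L : FirstOrder.Language.{u, v}} [L.IsAlgebraic] [Encodable (Σ l, L.Functions l)]
    (α : ℕ) {n : ℕ} (φ : InfFormula L n) : Prop :=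
  ∃ σ π : InfFormula L n, IsComputableSigma α σ ∧ IsComputablePi α π ∧ φ = .conj σ π

/-- The sentence `φ` is a Scott sentence of `A`: its countable models are exactly the isomorphic
copies of `A`. (Every countable structure has a copy in `Type`.) -/
def IsScottSentence {L : FirstOrder.Language.{u, v}} (A : Type) [L.Structure A] (φ : InfFormula L 0) : Prop :=
  ∀ (B : Type) [L.Structure B] [Countable B], φ.Realize B Fin.elim0 ↔ Nonempty (A ≃[L] B)

/-! ### The structures -/

/-- The finite tuple `a` generates `A`. -/
def Generates (L : FirstOrder.Language.{u, v}) {A : Type} [L.Structure A] {n : ℕ} (a : Fin n → A) : Prop :=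
  FirstOrder.Language.Substructure.closure L (Set.range a) = ⊤

/-- The tuple `b` satisfies the finite conjunction of equations `ψ`. -/
def SatEqs {L : FirstOrder.Language.{u, v}} {B : Type} [L.Structure B] {n : ℕ}
    (ψ : List (L.Term (Fin n) × L.Term (Fin n))) (b : Fin n → B) : Prop :=
  ∀ p ∈ ψ, p.1.realize b = p.2.realize b

/-- `A` is finitely presented in the class `K` (for instance all `L`-structures, or all groups):
`A` belongs to `K` and `A = ⟨a | ψ⟩` for some finite generating tuple `a` and some finite
conjunction `ψ` of atomic formulas (which are equations, in a language without relation symbols).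
That is, `ψ` holds at `a`, and each tuple satisfying `ψ` in a member `B` of `K` is the image of `a`
under a homomorphism `A → B`. -/
def IsFinitelyPresentedIn {L : FirstOrder.Language.{u, v}} (K : (B : Type) → [L.Structure B] → Prop)
    (A : Type) [L.Structure A] : Prop :=
  K A ∧ ∃ (n : ℕ) (a : Fin n → A) (ψ : List (L.Term (Fin n) × L.Term (Fin n))),
    Generates L a ∧ SatEqs ψ a ∧
      ∀ (B : Type) [L.Structure B], K B → ∀ b : Fin n → B, SatEqs ψ b →
        ∃ h : A →[L] B, ∀ i, h (a i) = b i

/-- `A` is Hopfian: every surjective endomorphism is an automorphism. -/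
def IsHopfian (L : FirstOrder.Language.{u, v}) (A : Type) [L.Structure A] : Prop :=
  ∀ f : A →[L] A, Function.Surjective f → ∃ g : A ≃[L] A, ∀ x, g x = f x

/-- A structure with domain `D ⊆ ℕ`, in a finite language without relation symbols, is computable:
`D` is a computable set, and each basic operation is (the restriction to `D` of) a computable
function. -/
def IsComputableStructure (L : FirstOrder.Language.{u, v}) (D : Set ℕ) [L.Structure D] : Prop :=
  ComputablePred (fun k : ℕ => k ∈ D) ∧
    ∀ (n : ℕ) (f : L.Functions n), ∃ g : (Fin n → ℕ) → ℕ, Computable g ∧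
      ∀ x : Fin n → D, ((FirstOrder.Language.Structure.funMap f x : D) : ℕ) = g fun i => (x i : ℕ)

/-- The structure with domain `D ⊆ ℕ` has decidable weak Whitehead problem: for every finite
generating tuple `a`, the set `{α(a) : α ∈ Aut(D)}` is a computable set of `n`-tuples. -/
def DecidableWeakWhitehead (L : FirstOrder.Language.{u, v}) (D : Set ℕ) [L.Structure D] : Prop :=
  ∀ (n : ℕ) (a : Fin n → D), Generates L a →
    ComputablePred fun x : Fin n → ℕ => ∃ α : D ≃[L] D, ∀ i, x i = (α (a i) : ℕ)

end CompScott

open CompScott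

namespace CompScott

open FirstOrder.Language

universe u v w

/-! ### Computably enumerable predicates -/

section Recursion

variable {α β γ σ τ : Type*} [Primcodable α] [Primcodable β] [Primcodable γ] [Primcodable σ]
  [Primcodable τ]

/-! Both directions rest on one consequence of the Hopf property. If `a` generates `A` and `E`
presents `A` on `a`, then `x` lies in the orbit of `a` exactly when `x` satisfies `E` and generates
`A` (`mem_orbit_iff`): `E` gives an endomorphism taking `a` to `x`, generation makes it onto, and so
it is an automorphism. Orbits of generating tuples are therefore always c.e.; only their complements
are at stake.

From decidable orbits to a sentence: let `T` be the set of term tuples `t` with `t(a)` outside the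
orbit of `a`. `OrbitFormula` says of `x` that it has the same equations as `a` and that `x = t(y)`
with `ψ(y)` is unsolvable for all `t ∈ T`. It is a c.e. conjunction of universal formulas, it holds
at `a`, and in `A` it forces `x` into the orbit (`orbitFormula_iff`). The Scott sentence says that
some `x` satisfies it and that every such `x` generates. Any model is then generated by a tuple with
the same equations as `a`, so it is a copy of `A`.

From a sentence to decidable orbits: fix a disjunct of the `Σ₂` part true in `A`, with its `Π₁`
matrix. Force with nonempty, automorphism-invariant sets of sequences from `A` defined by a co-c.e.
condition on finitely many terms. If no condition forced an initial segment to generate `A`, a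
descending sequence of conditions could both supply witnesses for the `Π₂` part and repeatedly
choose an element outside the substructure generated so far. The limit (`exists_limit_structure`)
would be a countable model of the sentence that is not finitely generated, although every model is a
copy of the finitely generated `A` (`exists_isBasic_generates`). Hence some nonempty invariant
co-c.e. set of tuples consists of generating tuples. If `c = r(a)` belongs to it and `x` satisfies
`E`, then `x` is in the orbit of `a` if and only if `r(x)` belongs to it. This makes the complement
of the orbit c.e. (`decidableWeakWhitehead_of_exists_rePred`).

The coding rests on a stack machine that reads any list of numbers as a list of terms
(`exists_terms_stackRun`). Searches over terms become searches over words, and one word gives both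
the values of the terms in `A` and their spelling inside Gödel numbers. -/

theorem rePred_of_computable_exists {p : α → Prop} (f : α × ℕ → Bool) (hf : Computable f)
    (h : ∀ a, p a ↔ ∃ n, f (a, n) = true) : REPred p := by
  have h1 : Partrec fun a => Nat.rfind fun n => Part.some (f (a, n)) := Partrec.rfind hf.partrec
  refine h1.dom_re.of_eq fun a => ?_
  refine Iff.trans Nat.rfind_dom ?_
  rw [h a]
  constructor
  · rintro ⟨n, hn, -⟩
    exact ⟨n, by simpa using hn⟩
  · rintro ⟨n, hn⟩
    exact ⟨n, by simpa using hn, fun _ => trivial⟩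

/-- Step-bounded evaluation is decidable, so a c.e. predicate is one unbounded search over `ℕ`. The
closure properties that follow combine such searches. -/
theorem rePred_iff_exists_computable {p : α → Prop} :
    REPred p ↔ ∃ f : α × ℕ → Bool, Computable f ∧ ∀ a, p a ↔ ∃ n, f (a, n) = true := by
  constructor
  · intro hp
    obtain ⟨c, hc⟩ := Nat.Partrec.Code.exists_code.1 hp
    refine ⟨fun q => (Nat.Partrec.Code.evaln q.2 c (Encodable.encode q.1)).isSome, ?_, ?_⟩
    · exact (Primrec.option_isSome.comp (Nat.Partrec.Code.primrec_evaln.comp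
        ((Primrec.snd.pair (Primrec.const c)).pair (Primrec.encode.comp Primrec.fst)))).to_comp
    · intro a
      have h1 : p a ↔ (c.eval (Encodable.encode a)).Dom := by
        rw [hc]
        simp [Part.dom_iff_mem, Encodable.encodek]
      rw [h1, Part.dom_iff_mem]
      simp only [Nat.Partrec.Code.evaln_complete, Option.isSome_iff_exists, Option.mem_def]
      exact exists_comm
  · rintro ⟨f, hf, h⟩
    exact rePred_of_computable_exists f hf h

theorem _root_.REPred.comp {p : β → Prop} (hp : REPred p) {f : α → β} (hf : Computable f) :
    REPred fun a => p (f a) :=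
  Partrec.comp hp hf

theorem rePred_eq_true {f : α → Bool} (hf : Computable f) : REPred fun a => f a = true :=
  ComputablePred.to_re (ComputablePred.computable_iff.2 ⟨f, hf, rfl⟩)

theorem _root_.REPred.exists {p : α → β → Prop} (hp : REPred fun q : α × β => p q.1 q.2) :
    REPred fun a => ∃ b, p a b := by
  obtain ⟨f, hf, h⟩ := rePred_iff_exists_computable.1 hp
  refine rePred_of_computable_exists
    (fun q => ((Encodable.decode (α := β) q.2.unpair.1).map
      fun b => f ((q.1, b), q.2.unpair.2)).getD false) ?_ ?_
  · refine Computable.option_getD (Computable.option_map ?_ ?_) (Computable.const false)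
    · exact Computable.decode.comp
        (Computable.fst.comp (Computable.unpair.comp Computable.snd))
    · exact hf.comp (((Computable.fst.comp Computable.fst).pair Computable.snd).pair
        (Computable.snd.comp (Computable.unpair.comp (Computable.snd.comp Computable.fst))))
  · intro a
    constructor
    · rintro ⟨b, hb⟩
      obtain ⟨n, hn⟩ := (h (a, b)).1 hb
      exact ⟨Nat.pair (Encodable.encode b) n, by simpa using hn⟩
    · rintro ⟨n, hn⟩
      simp only [Option.getD_eq_iff, Option.map_eq_some_iff] at hn
      rcases hn with ⟨b, -, hb⟩ | ⟨-, hb⟩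
      · exact ⟨b, (h (a, b)).2 ⟨_, hb⟩⟩
      · cases hb

theorem _root_.REPred.and {p q : α → Prop} (hp : REPred p) (hq : REPred q) :
    REPred fun a => p a ∧ q a := by
  obtain ⟨f, hf, h⟩ := rePred_iff_exists_computable.1 hp
  obtain ⟨g, hg, h'⟩ := rePred_iff_exists_computable.1 hq
  have : REPred fun a => ∃ n : ℕ × ℕ, (f (a, n.1) && g (a, n.2)) = true := by
    apply REPred.exists
    apply rePred_eq_true
    exact Primrec.and.to_comp.comp
      (hf.comp (Computable.fst.pair (Computable.fst.comp Computable.snd)))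
      (hg.comp (Computable.fst.pair (Computable.snd.comp Computable.snd)))
  refine this.of_eq fun a => ?_
  simp [h, h']

theorem _root_.REPred.or {p q : α → Prop} (hp : REPred p) (hq : REPred q) :
    REPred fun a => p a ∨ q a := by
  obtain ⟨f, hf, h⟩ := rePred_iff_exists_computable.1 hp
  obtain ⟨g, hg, h'⟩ := rePred_iff_exists_computable.1 hq
  have : REPred fun a => ∃ n : ℕ, (f (a, n) || g (a, n)) = true := by
    apply REPred.exists
    apply rePred_eq_true
    exact Primrec.or.to_comp.comp hf hg
  refine this.of_eq fun a => ?_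
  simp [h, h', exists_or]

theorem rePred_forall_fin {n : ℕ} {p : Fin n → α → Prop} (hp : ∀ i, REPred (p i)) :
    REPred fun a => ∀ i, p i a := by
  induction n with
  | zero => exact (rePred_eq_true (Computable.const true)).of_eq fun a => by simp
  | succ n ih =>
    exact ((hp 0).and (ih fun i => hp i.succ)).of_eq fun a => by rw [Fin.forall_fin_succ]

theorem _root_.REPred.ne_true {f : α → Bool} (hf : Computable f) : REPred fun a => ¬ f a = true :=
  (rePred_eq_true (Primrec.not.to_comp.comp hf)).of_eq fun a => by simp

theorem rePred_eq [DecidableEq σ] {f g : α → σ} (hf : Computable f) (hg : Computable g) :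
    REPred fun a => f a = g a := by
  have h : Computable₂ fun a b : σ => decide (a = b) := by
    have := (Primrec.eq (α := σ)).decide.to_comp
    exact this
  exact (rePred_eq_true (h.comp hf hg)).of_eq fun a => by simp

theorem computable_decide_eq [DecidableEq σ] {f g : α → σ} (hf : Computable f)
    (hg : Computable g) : Computable fun a => decide (f a = g a) := by
  have h : Computable₂ fun a b : σ => decide (a = b) := (Primrec.eq (α := σ)).decide.to_comp
  exact h.comp hf hg

theorem computable_list_foldl {f : α → List β} {g : α → σ} {h : α → σ × β → σ}
    (hf : Computable f) (hg : Computable g) (hh : Computable₂ h) :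
    Computable fun a => (f a).foldl (fun s b => h a (s, b)) (g a) := by
  have h1 : Computable fun a => (Nat.rec (g a)
      (fun i s => ((f a)[i]?.map fun b => h a (s, b)).getD s) (f a).length : σ) := by
    refine Computable.nat_rec (h := fun a p => ((f a)[p.1]?.map fun b => h a (p.2, b)).getD p.2)
      (Computable.list_length.comp hf) hg ?_
    refine Computable.option_getD (Computable.option_map ?_ ?_)
      (Computable.snd.comp Computable.snd)
    · exact Computable.list_getElem?.comp (hf.comp Computable.fst)
        (Computable.fst.comp Computable.snd)
    · exact hh.comp (Computable.fst.comp Computable.fst)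
        ((Computable.snd.comp (Computable.snd.comp Computable.fst)).pair Computable.snd)
  refine h1.of_eq fun a => ?_
  have key : ∀ k ≤ (f a).length, (Nat.rec (g a)
      (fun i s => ((f a)[i]?.map fun b => h a (s, b)).getD s) k : σ) =
      ((f a).take k).foldl (fun s b => h a (s, b)) (g a) := by
    intro k
    induction k with
    | zero => simp
    | succ k ih =>
      intro hk
      rw [List.take_add_one, List.foldl_append, ← ih (by omega)]
      simp [List.getElem?_eq_getElem (show k < (f a).length by omega)]
  simpa using key _ le_rfl

theorem computable_list_foldr {f : α → List β} {g : α → σ} {h : α → β × σ → σ}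
    (hf : Computable f) (hg : Computable g) (hh : Computable₂ h) :
    Computable fun a => (f a).foldr (fun b s => h a (b, s)) (g a) := by
  have := computable_list_foldl (h := fun a p => h a (p.2, p.1)) (Computable.list_reverse.comp hf)
    hg (hh.comp Computable.fst
      ((Computable.snd.comp Computable.snd).pair (Computable.fst.comp Computable.snd)))
  exact this.of_eq fun a => by simp

theorem computable_list_all {f : α → List β} {h : α → β → Bool}
    (hf : Computable f) (hh : Computable₂ h) :
    Computable fun a => (f a).all (h a) := by
  have := computable_list_foldr (h := fun a p => h a p.1 && p.2) hf (Computable.const true)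
    (Primrec.and.to_comp.comp (hh.comp Computable.fst (Computable.fst.comp Computable.snd))
      (Computable.snd.comp Computable.snd))
  refine this.of_eq fun a => ?_
  induction f a with
  | nil => rfl
  | cons b l ih => simp [ih]

theorem computable_list_map {f : α → List β} {h : α → β → σ}
    (hf : Computable f) (hh : Computable₂ h) :
    Computable fun a => (f a).map (h a) := by
  have := computable_list_foldr (h := fun a p => h a p.1 :: p.2) hf (Computable.const [])
    (Computable.list_cons.comp (hh.comp Computable.fst (Computable.fst.comp Computable.snd))
      (Computable.snd.comp Computable.snd))
  refine this.of_eq fun a => ?_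
  induction f a with
  | nil => rfl
  | cons b l ih => simp [ih]

theorem computable_ofFn_coe (n : ℕ) : Computable fun x : Fin n → σ => List.ofFn x := by
  have : ∀ i : Fin n, Primrec fun x : Fin n → σ => x i := fun i =>
    Primrec.fin_app.comp Primrec.id (Primrec.const i)
  exact (Primrec.list_ofFn this).to_comp

theorem computable_getI (n : ℕ) [Inhabited σ] :
    Computable fun (l : List σ) (i : Fin n) => l.getI i := by
  have h : Primrec₂ fun (l : List σ) (i : Fin n) => l.getI i :=
    Primrec.list_getI.comp Primrec.fst (Primrec.fin_val.comp Primrec.snd)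
  exact (Primrec.fin_curry.2 h).to_comp

/-- A function defined by finitely many cases, on codes of the case, is computable. -/
theorem exists_computable_of_finite {ι : Type*} [Finite ι] [Encodable ι] [Inhabited σ]
    (h : ι → α → σ) (hh : ∀ i, Computable (h i)) :
    ∃ H : ℕ → α → σ, Computable₂ H ∧ (∀ i, H (Encodable.encode i) = h i) ∧
      ∀ c, (∀ i : ι, Encodable.encode i ≠ c) → ∀ a, H c a = default := by
  classical
  have := Fintype.ofFinite ι
  suffices key : ∀ s : Finset ι, ∃ H : ℕ → α → σ, Computable₂ H ∧
      (∀ i ∈ s, H (Encodable.encode i) = h i) ∧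
      ∀ c, (∀ i : ι, Encodable.encode i ≠ c) → ∀ a, H c a = default by
    obtain ⟨H, h1, h2, h3⟩ := key Finset.univ
    exact ⟨H, h1, fun i => h2 i (Finset.mem_univ i), h3⟩
  intro s
  induction s using Finset.induction_on with
  | empty => exact ⟨fun _ _ => default, Computable.const _, by simp, by simp⟩
  | insert i s _ ih =>
    obtain ⟨H, h1, h2, h3⟩ := ih
    refine ⟨fun c a => cond (decide (c = Encodable.encode i)) (h i a) (H c a), ?_, ?_, ?_⟩
    · exact Computable.cond (computable_decide_eq Computable.fst (Computable.const _))
        ((hh i).comp Computable.snd) h1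
    · intro j hj
      funext a
      by_cases hji : j = i
      · subst hji; simp
      · have : Encodable.encode j ≠ Encodable.encode i :=
          fun e => hji (Encodable.encode_injective e)
        simp [this, h2 j ((Finset.mem_insert.1 hj).resolve_left hji)]
    · intro c hc a
      have : c ≠ Encodable.encode i := fun e => hc i e.symm
      simp [this, h3 c hc]

/-- The encoding of `ι` is arbitrary; finiteness alone makes its decoding computable. `decode₂`
returns a value only on actual codes, which fixes the behaviour on all other numbers. -/
theorem computable_decode₂_map {ι : Type*} [Finite ι] [Encodable ι] (f : ι → σ) :
    Computable fun c => (Encodable.decode₂ ι c).map f := by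
  obtain ⟨H, h1, h2, h3⟩ := exists_computable_of_finite (α := Unit)
    (fun (i : ι) _ => some (f i)) fun _ => Computable.const _
  refine (h1.comp Computable.id (Computable.const ())).of_eq fun c => ?_
  by_cases hc : ∃ i : ι, Encodable.encode i = c
  · obtain ⟨i, rfl⟩ := hc
    simp [h2, Encodable.decode₂_encode]
  · have h4 : Encodable.decode₂ ι c = none := by
      rw [Option.eq_none_iff_forall_ne_some]
      intro i hi
      exact hc ⟨i, Encodable.decode₂_eq_some.1 hi⟩
    rw [h4]
    exact h3 c (fun i hi => hc ⟨i, hi⟩) ()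

theorem rePred_mem_W : REPred fun p : ℕ × ℕ => p.2 ∈ W p.1 :=
  (Partrec.dom_re (Nat.Partrec.Code.eval_part.comp
    ((Computable.ofNat Nat.Partrec.Code).comp Computable.fst) Computable.snd)).of_eq fun _ => Iff.rfl

theorem exists_W_eq {S : Set ℕ} (hS : REPred fun k => k ∈ S) : ∃ e, W e = S := by
  have h : Partrec fun k => (Part.assert (k ∈ S) fun _ => Part.some ()).map fun _ => (0 : ℕ) :=
    Partrec.map hS (Computable.const 0).to₂
  obtain ⟨c, hc⟩ := Nat.Partrec.Code.exists_code.1 (Partrec.nat_iff.1 h)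
  refine ⟨Encodable.encode c, ?_⟩
  ext k
  simp [W, hc, Part.assert]

end Recursion

/-! ### A stack machine for words in prefix notation -/

section Machine

/-- One step of the evaluation of a word in prefix notation: even symbols are variables, odd symbols
are operations, which are applied to the top of the stack. -/
def stackStep {X : Type*} (ar : ℕ → Option ℕ) (op : ℕ → List X → X) (vr : ℕ → Option X) (s : ℕ)
    (st : List X) : List X :=
  bif s.bodd then
    ((ar s.div2).map fun k =>
      bif decide (k ≤ st.length) then op s.div2 (st.take k) :: st.drop k else []).getD []
  else ((vr s.div2).map fun x => x :: st).getD []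

/-- The final stack after the evaluation of a word from right to left. -/
def stackRun {X : Type*} (ar : ℕ → Option ℕ) (op : ℕ → List X → X) (vr : ℕ → Option X)
    (w : List ℕ) : List X :=
  w.foldr (stackStep ar op vr) []

theorem computable_stackRun {γ X : Type*} [Primcodable γ] [Primcodable X] {ar : ℕ → Option ℕ}
    (har : Computable ar) {op : ℕ → List X → X} (hop : Computable₂ op) {vr : γ → ℕ → Option X}
    (hvr : Computable₂ vr) {w : γ → List ℕ} (hw : Computable w) :
    Computable fun a => stackRun ar op (vr a) (w a) := by
  refine computable_list_foldr (h := fun a p => stackStep ar op (vr a) p.1 p.2) hw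
    (Computable.const []) ?_
  have hs : Computable fun p : γ × ℕ × List X => p.2.1 := Computable.fst.comp Computable.snd
  have hst : Computable fun p : γ × ℕ × List X => p.2.2 := Computable.snd.comp Computable.snd
  have hd : Computable fun p : γ × ℕ × List X => p.2.1.div2 := Computable.nat_div2.comp hs
  refine Computable.cond (Computable.nat_bodd.comp hs)
    (Computable.option_getD (Computable.option_map (har.comp hd) ?_) (Computable.const []))
    (Computable.option_getD (Computable.option_map
      (hvr.comp Computable.fst hd) ?_) (Computable.const []))
  · have hst' : Computable fun p : (γ × ℕ × List X) × ℕ => p.1.2.2 := hst.comp Computable.fst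
    have hle : Computable₂ fun a b : ℕ => decide (a ≤ b) := Primrec.nat_le.decide.to_comp
    exact Computable.cond (hle.comp Computable.snd (Computable.list_length.comp hst'))
      (Computable.list_cons.comp
        (hop.comp (hd.comp Computable.fst) (Primrec.list_take.to_comp.comp Computable.snd hst'))
        (Primrec.list_drop.to_comp.comp Computable.snd hst'))
      (Computable.const [])
  · exact Computable.list_cons.comp Computable.snd (hst.comp Computable.fst)

end Machine

/-! ### Words of terms and their evaluation in arbitrary algebras. -/

section Words

variable {L : FirstOrder.Language.{u, v}} [Encodable (Σ l, L.Functions l)]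

variable (L) in
/-- The arity of the function symbol with a given code. -/
noncomputable def arity (c : ℕ) : Option ℕ :=
  (Encodable.decode₂ (Σ l, L.Functions l) c).map Sigma.fst

theorem arity_encode {l : ℕ} (f : L.Functions l) :
    arity L (Encodable.encode (⟨l, f⟩ : Σ l, L.Functions l)) = some l := by
  simp [arity, Encodable.decode₂_encode]

theorem arity_eq_some {c k : ℕ} (h : arity L c = some k) :
    ∃ f : L.Functions k, Encodable.encode (⟨k, f⟩ : Σ l, L.Functions l) = c := by
  simp only [arity, Option.map_eq_some_iff, Encodable.decode₂_eq_some] at h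
  obtain ⟨⟨k', f⟩, h1, rfl⟩ := h
  exact ⟨f, h1⟩

theorem computable_arity [Finite (Σ l, L.Functions l)] : Computable (arity L) :=
  computable_decode₂_map Sigma.fst

variable {α : Type*}

/-- The word of a term in prefix notation, for a numbering of the variables. -/
noncomputable def termWord (ρ : α → ℕ) : L.Term α → List ℕ
  | .var a => [2 * ρ a]
  | .func (l := l) f ts =>
    (2 * Encodable.encode (⟨l, f⟩ : Σ l, L.Functions l) + 1) ::
      (List.ofFn fun i => termWord ρ (ts i)).flatten

theorem termWord_relabel {β : Type*} (ρ : β → ℕ) (g : α → β) (t : L.Term α) :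
    termWord ρ (t.relabel g) = termWord (fun a => ρ (g a)) t := by
  induction t with
  | var a => rfl
  | func f ts ih => simp only [Term.relabel, termWord, ih]

/-- `V` evaluates terms in the algebra with operations `op`, the variables having the values
`vr`. -/
structure IsValuation [Encodable α] {X : Type*} (op : ℕ → List X → X) (vr : ℕ → Option X)
    (V : L.Term α → X) : Prop where
  var : ∀ a : α, vr (Encodable.encode a) = some (V (.var a))
  not_var : ∀ c, (∀ a : α, Encodable.encode a ≠ c) → vr c = none
  func : ∀ {l : ℕ} (f : L.Functions l) (ts : Fin l → L.Term α), V (.func f ts) =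
    op (Encodable.encode (⟨l, f⟩ : Σ l, L.Functions l)) (List.ofFn fun i => V (ts i))

variable [Encodable α]

/-- A complete term pushes one value and leaves the stack below it untouched. Since reading goes
from right to left, the arguments of a function symbol end up on top in their own order. The suffix
`w` must be arbitrary for the induction. -/
theorem stackRun_termWord_append {X : Type*} {op : ℕ → List X → X} {vr : ℕ → Option X}
    {V : L.Term α → X} (hV : IsValuation op vr V) (t : L.Term α) (w : List ℕ) :
    stackRun (arity L) op vr (termWord Encodable.encode t ++ w) =
      V t :: stackRun (arity L) op vr w := by
  induction t generalizing w with
  | var a => simp [termWord, stackRun, stackStep, hV.var]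
  | @func l f ts ih =>
    have key : ∀ {m : ℕ} (us : Fin m → L.Term α), (∀ i w,
        stackRun (arity L) op vr (termWord Encodable.encode (us i) ++ w) =
          V (us i) :: stackRun (arity L) op vr w) →
        stackRun (arity L) op vr
          ((List.ofFn fun i => termWord Encodable.encode (us i)).flatten ++ w) =
          (List.ofFn fun i => V (us i)) ++ stackRun (arity L) op vr w := by
      intro m
      induction m with
      | zero => simp
      | succ m ihm =>
        intro us h
        rw [List.ofFn_succ, List.flatten_cons, List.append_assoc, h, List.ofFn_succ,
          ihm _ fun i => h i.succ, List.cons_append]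
    have h1 := key ts ih
    rw [termWord, List.cons_append, stackRun, List.foldr_cons]
    rw [stackRun] at h1
    rw [h1, stackStep, hV.func]
    have h2 : (2 * Encodable.encode (⟨l, f⟩ : Σ l, L.Functions l) + 1).div2 =
        Encodable.encode (⟨l, f⟩ : Σ l, L.Functions l) := by
      rw [Nat.div2_val]; omega
    have h3 : (2 * Encodable.encode (⟨l, f⟩ : Σ l, L.Functions l) + 1).bodd = true := by simp
    rw [h2, h3, arity_encode]
    simp [stackRun]

theorem stackRun_flatMap {X : Type*} {op : ℕ → List X → X} {vr : ℕ → Option X}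
    {V : L.Term α → X} (hV : IsValuation op vr V) (ts : List (L.Term α)) :
    stackRun (arity L) op vr (ts.flatMap (termWord Encodable.encode)) = ts.map V := by
  induction ts with
  | nil => rfl
  | cons t ts ih => rw [List.flatMap_cons, stackRun_termWord_append hV, ih, List.map_cons]

/-- Every word evaluates to the values of a list of terms, the same one in all algebras. -/
theorem exists_terms_stackRun (w : List ℕ) : ∃ ts : List (L.Term α),
    ∀ {X : Type} {op : ℕ → List X → X} {vr : ℕ → Option X} {V : L.Term α → X},
      IsValuation op vr V → stackRun (arity L) op vr w = ts.map V := by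
  induction w with
  | nil => exact ⟨[], fun _ => rfl⟩
  | cons s w ih =>
    obtain ⟨ts, hts⟩ := ih
    have hcons : ∀ {X : Type} {op : ℕ → List X → X} {vr : ℕ → Option X} {V : L.Term α → X},
        IsValuation op vr V → stackRun (arity L) op vr (s :: w) =
          stackStep (arity L) op vr s (ts.map V) := by
      intro X op vr V hV
      rw [← hts hV]; rfl
    cases hs : s.bodd
    · by_cases ha : ∃ a : α, Encodable.encode a = s.div2
      · obtain ⟨a, ha⟩ := ha
        refine ⟨.var a :: ts, fun hV => ?_⟩
        rw [hcons hV, stackStep, hs, ← ha, hV.var]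
        simp
      -- An unknown symbol, or too few arguments, clears the stack whatever the algebra is, so the
      -- empty list of terms serves uniformly.
      · refine ⟨[], fun hV => ?_⟩
        rw [hcons hV, stackStep, hs, hV.not_var _ fun a h => ha ⟨a, h⟩]
        simp
    · cases har : arity L s.div2 with
      | none =>
        refine ⟨[], fun hV => ?_⟩
        rw [hcons hV, stackStep, hs, har]
        simp
      | some k =>
        obtain ⟨f, hf⟩ := arity_eq_some har
        by_cases hk : k ≤ ts.length
        · refine ⟨.func f (fun i => ts[i]) :: ts.drop k, fun {X op vr V} hV => ?_⟩
          rw [hcons hV, stackStep, hs, har, List.map_cons, hV.func, hf]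
          have : (List.ofFn fun i : Fin k => V ts[i]) = (ts.map V).take k := by
            apply List.ext_getElem
            · simp [hk]
            · intro i h1 h2
              simp
          rw [this]
          simp [hk, List.map_drop]
        · refine ⟨[], fun hV => ?_⟩
          rw [hcons hV, stackStep, hs, har]
          simp [hk]

/-- Words themselves form an algebra, in which evaluating a word respells its terms with the
variables renumbered by `ρ`. Running the machine here and in `A` on the same input yields a term's
spelling together with its value. -/
theorem isValuation_termWord (ρ : α → ℕ) :
    IsValuation (fun c args => (2 * c + 1) :: args.flatten)
      (fun c => (Encodable.decode₂ α c).map fun a => [2 * ρ a]) (termWord (L := L) ρ) where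
  var a := by simp [termWord, Encodable.decode₂_encode]
  not_var c hc := by
    have : Encodable.decode₂ α c = none := by
      rw [Option.eq_none_iff_forall_ne_some]
      intro a ha
      exact hc a (Encodable.decode₂_eq_some.1 ha)
    simp [this]
  func f ts := rfl

theorem encode_list_map {β : Type*} [Encodable β] (l : List β) :
    Encodable.encode (l.map Encodable.encode) = Encodable.encode l := by
  induction l with
  | nil => rfl
  | cons a l ih => simp only [List.map_cons, Encodable.encode_list_cons, ih, Encodable.encode_nat]

theorem encode_term (t : L.Term α) :
    Encodable.encode t = Encodable.encode (termWord Encodable.encode t) := by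
  have h : termWord Encodable.encode t = t.listEncode.map Encodable.encode := by
    induction t with
    | var a => simp [termWord, Term.listEncode]
    | func f ts ih =>
      simp only [termWord, Term.listEncode, ih, List.map_cons, Encodable.encode_inr,
        List.ofFn_eq_map, List.flatMap_def, List.map_flatten, List.map_map, Function.comp_def]
  rw [h, encode_list_map]
  rfl

end Words

/-! ### Generating tuples -/

section Generation

variable {L : FirstOrder.Language.{u, v}}

theorem mem_closure_range_iff {B : Type} [L.Structure B] {ι : Type} {x : ι → B} {z : B} :
    z ∈ Substructure.closure L (Set.range x) ↔ ∃ t : L.Term ι, t.realize x = z := by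
  rw [Substructure.mem_closure_iff_exists_term]
  constructor
  · rintro ⟨t, rfl⟩
    refine ⟨t.relabel fun a => a.2.choose, ?_⟩
    rw [Term.realize_relabel]
    congr 1
    funext a
    exact a.2.choose_spec
  · rintro ⟨t, rfl⟩
    refine ⟨t.relabel fun i => ⟨x i, i, rfl⟩, ?_⟩
    rw [Term.realize_relabel]
    rfl

theorem Generates.iff_terms {B : Type} [L.Structure B] {n : ℕ} {a : Fin n → B} :
    Generates L a ↔ ∀ z, ∃ t : L.Term (Fin n), t.realize a = z := by
  simp only [← mem_closure_range_iff, Generates, eq_top_iff, SetLike.le_def,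
    Substructure.mem_top, true_imp_iff]

theorem Generates.of_hom_surjective {B C : Type} [L.Structure B] [L.Structure C] {n : ℕ}
    {a : Fin n → B} (ha : Generates L a) (h : B →[L] C) (hs : Function.Surjective h) :
    Generates L (h ∘ a) := by
  rw [Generates.iff_terms] at ha ⊢
  intro z
  obtain ⟨y, rfl⟩ := hs z
  obtain ⟨t, rfl⟩ := ha y
  exact ⟨t, HomClass.realize_term h⟩

theorem Generates.surjective_of_hom {B C : Type} [L.Structure B] [L.Structure C] {n : ℕ}
    {a : Fin n → B} (h : B →[L] C) (ha : Generates L (h ∘ a)) : Function.Surjective h := by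
  rw [Generates.iff_terms] at ha
  intro z
  obtain ⟨t, rfl⟩ := ha z
  exact ⟨t.realize a, (HomClass.realize_term h).symm⟩

end Generation

/-! ### Evaluation of terms in a computable structure -/

section Evaluation

variable {L : FirstOrder.Language.{u, v}} [Encodable (Σ l, L.Functions l)]

/-- `op` computes the basic operations of `A` on lists of arguments, from codes of the function
symbols. -/
structure ComputesOps (L : FirstOrder.Language.{u, v}) [Encodable (Σ l, L.Functions l)]
    (A : Set ℕ) [L.Structure A] (op : ℕ → List ℕ → ℕ) : Prop where
  computable : Computable₂ op
  apply : ∀ {l : ℕ} (f : L.Functions l) (y : Fin l → A),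
    op (Encodable.encode (⟨l, f⟩ : Σ l, L.Functions l)) (List.ofFn fun i => (y i : ℕ)) =
      (Structure.funMap f y : A)

theorem IsComputableStructure.exists_computesOps [Finite (Σ l, L.Functions l)] {A : Set ℕ}
    [L.Structure A] (h : IsComputableStructure L A) : ∃ op, ComputesOps L A op := by
  choose g hg hgA using h.2
  obtain ⟨H, h1, h2, -⟩ := exists_computable_of_finite
    (fun (f : Σ l, L.Functions l) (args : List ℕ) => g f.1 f.2 fun i => args.getI i)
    fun f => (hg f.1 f.2).comp (computable_getI f.1)
  refine ⟨H, h1, fun {l} f y => ?_⟩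
  rw [h2, hgA]
  simp only
  congr 1
  funext i
  rw [List.getI_eq_getElem _ (by simp)]
  simp

/-- The values of the terms listed by the word `w`, at the tuple listed by `x`. -/
noncomputable def evalWord (L : FirstOrder.Language.{u, v}) [Encodable (Σ l, L.Functions l)]
    (op : ℕ → List ℕ → ℕ) (x w : List ℕ) : List ℕ :=
  stackRun (arity L) op (fun c => x[c]?) w

theorem computable_evalWord [Finite (Σ l, L.Functions l)] {op : ℕ → List ℕ → ℕ}
    (hop : Computable₂ op) : Computable₂ (evalWord L op) :=
  computable_stackRun computable_arity hop (vr := fun (p : List ℕ × List ℕ) c => p.1[c]?)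
    (Computable.list_getElem?.comp (Computable.fst.comp Computable.fst) Computable.snd)
    Computable.snd

variable {A : Set ℕ} [L.Structure A] {op : ℕ → List ℕ → ℕ}

theorem ComputesOps.isValuation {α : Type*} [Encodable α] (hop : ComputesOps L A op) (x : α → A)
    (vr : ℕ → Option ℕ) (h1 : ∀ a, vr (Encodable.encode a) = some (x a : ℕ))
    (h2 : ∀ c, (∀ a : α, Encodable.encode a ≠ c) → vr c = none) :
    IsValuation op vr fun t : L.Term α => ((t.realize x : A) : ℕ) where
  var a := h1 a
  not_var := h2
  func f _ := (hop.apply f _).symm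

theorem encode_fin {n : ℕ} (i : Fin n) : Encodable.encode i = (i : ℕ) := rfl

theorem ComputesOps.isValuation_ofFn (hop : ComputesOps L A op) {n : ℕ} (x : Fin n → A) :
    IsValuation op (fun c => (List.ofFn fun i => (x i : ℕ))[c]?)
      fun t : L.Term (Fin n) => ((t.realize x : A) : ℕ) := by
  refine hop.isValuation x _ (fun a => ?_) fun c hc => ?_
  · simp only [List.getElem?_ofFn, encode_fin, a.is_lt, dif_pos, Fin.eta]
  · rw [List.getElem?_eq_none_iff]
    by_contra hlt
    simp only [List.length_ofFn, not_le] at hlt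
    exact hc ⟨c, hlt⟩ rfl

theorem evalWord_flatMap (hop : ComputesOps L A op) {n : ℕ} (x : Fin n → A)
    (ts : List (L.Term (Fin n))) :
    evalWord L op (List.ofFn fun i => (x i : ℕ)) (ts.flatMap (termWord fun i : Fin n => (i : ℕ))) =
      ts.map fun t => ((t.realize x : A) : ℕ) :=
  stackRun_flatMap (hop.isValuation_ofFn x) ts

/-- This makes membership in a finitely generated substructure c.e.: the search runs over all words,
and only the top of the final stack matters. -/
theorem mem_closure_range_iff_evalWord (hop : ComputesOps L A op) {n : ℕ} {x : Fin n → A} {z : A} :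
    z ∈ Substructure.closure L (Set.range x) ↔
      ∃ w, (evalWord L op (List.ofFn fun i => (x i : ℕ)) w).head? = some (z : ℕ) := by
  rw [mem_closure_range_iff]
  constructor
  · rintro ⟨t, rfl⟩
    exact ⟨[t].flatMap (termWord fun i : Fin n => (i : ℕ)), by rw [evalWord_flatMap hop]; rfl⟩
  · rintro ⟨w, hw⟩
    obtain ⟨ts, hts⟩ := exists_terms_stackRun (L := L) (α := Fin n) w
    rw [evalWord, hts (hop.isValuation_ofFn x)] at hw
    cases ts with
    | nil => simp at hw
    | cons t ts => exact ⟨t, Subtype.ext (by simpa using hw)⟩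

end Evaluation

/-! ### Evaluation of quantifier-free formulas -/

section Formulas

variable {L : FirstOrder.Language.{u, v}} [Encodable (Σ l, L.Functions l)]

/-- One step of the evaluation of a formula in prefix notation. Truth values are `0` and `1`, and
`v + 2` stands for the right-hand side `v` of an equation. -/
noncomputable def formulaStep (L : FirstOrder.Language.{u, v}) [Encodable (Σ l, L.Functions l)]
    (op : ℕ → List ℕ → ℕ) (x : List ℕ) (c : ℕ) (st : List ℕ) : List ℕ :=
  bif c.bodd then
    bif decide (c = 3) then
      (bif decide (st.headI = 0) then 1 else st.tail.headI) :: st.tail.tail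
    else 0 :: st
  else
    let v := (stackRun (arity L) op (fun c => bif c.bodd then none else x[c.div2]?)
      (Denumerable.ofNat (List ℕ) c.div2.unpair.2)).headI
    bif decide (2 ≤ st.headI) then (bif decide (st.headI = v + 2) then 1 else 0) :: st.tail
    else (v + 2) :: st

/-- The truth value of the quantifier-free formula with a given code, at the tuple listed
by `x`. -/
noncomputable def formulaValue (L : FirstOrder.Language.{u, v}) [Encodable (Σ l, L.Functions l)]
    (op : ℕ → List ℕ → ℕ) (x : List ℕ) (c : ℕ) : Bool :=
  decide (((Denumerable.ofNat (List ℕ) c).foldr (formulaStep L op x) []).headI = 1)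

theorem computable_formulaValue [Finite (Σ l, L.Functions l)] {op : ℕ → List ℕ → ℕ}
    (hop : Computable₂ op) : Computable₂ (formulaValue L op) := by
  refine computable_decide_eq (Primrec.list_headI.to_comp.comp ?_) (Computable.const 1)
  refine computable_list_foldr (h := fun (p : List ℕ × ℕ) q => formulaStep L op p.1 q.1 q.2)
    ((Computable.ofNat (List ℕ)).comp Computable.snd) (Computable.const []) ?_
  have hx : Computable fun p : (List ℕ × ℕ) × ℕ × List ℕ => p.1.1 :=
    Computable.fst.comp Computable.fst
  have hc : Computable fun p : (List ℕ × ℕ) × ℕ × List ℕ => p.2.1 :=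
    Computable.fst.comp Computable.snd
  have hst : Computable fun p : (List ℕ × ℕ) × ℕ × List ℕ => p.2.2 :=
    Computable.snd.comp Computable.snd
  have hhead : Computable (List.headI : List ℕ → ℕ) := Primrec.list_headI.to_comp
  have htail : Computable (List.tail : List ℕ → List ℕ) := Primrec.list_tail.to_comp
  have hv : Computable fun p : (List ℕ × ℕ) × ℕ × List ℕ =>
      (stackRun (arity L) op (fun c => bif c.bodd then none else p.1.1[c.div2]?)
        (Denumerable.ofNat (List ℕ) p.2.1.div2.unpair.2)).headI := by
    refine hhead.comp (computable_stackRun computable_arity hop ?_ ?_)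
    · exact Computable.cond (Computable.nat_bodd.comp Computable.snd) (Computable.const none)
        (Computable.list_getElem?.comp (hx.comp Computable.fst)
          (Computable.nat_div2.comp Computable.snd))
    · exact (Computable.ofNat (List ℕ)).comp (Computable.snd.comp
        (Computable.unpair.comp (Computable.nat_div2.comp hc)))
  have hv2 := Computable.succ.comp (Computable.succ.comp hv)
  have hle : Computable₂ fun a b : ℕ => decide (a ≤ b) := Primrec.nat_le.decide.to_comp
  refine Computable.cond (Computable.nat_bodd.comp hc) ?_ ?_
  · refine Computable.cond (computable_decide_eq hc (Computable.const 3)) ?_ ?_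
    · exact Computable.list_cons.comp (Computable.cond
        (computable_decide_eq (hhead.comp hst) (Computable.const 0)) (Computable.const 1)
        (hhead.comp (htail.comp hst))) (htail.comp (htail.comp hst))
    · exact Computable.list_cons.comp (Computable.const 0) hst
  · refine Computable.cond (hle.comp (Computable.const 2) (hhead.comp hst)) ?_ ?_
    · exact Computable.list_cons.comp (Computable.cond
        (computable_decide_eq (hhead.comp hst) hv2) (Computable.const 1) (Computable.const 0))
        (htail.comp hst)
    · exact Computable.list_cons.comp hv2 hst

variable {A : Set ℕ} [L.Structure A] {op : ℕ → List ℕ → ℕ}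

/-- Terms inside formulas have variables in `Fin n ⊕ Fin 0`, where `Sum.inl i` has code `2 * i`; odd
codes name no variable. -/
theorem ComputesOps.isValuation_sum (hop : ComputesOps L A op) {n : ℕ} (x : Fin n → A)
    (y : Fin 0 → A) :
    IsValuation op
      (fun c => bif c.bodd then none else (List.ofFn fun i => (x i : ℕ))[c.div2]?)
      fun t : L.Term (Fin n ⊕ Fin 0) => ((t.realize (Sum.elim x y) : A) : ℕ) := by
  refine hop.isValuation _ _ (fun a => ?_) fun c hc => ?_
  · rcases a with a | a
    · simp [Nat.div2_val, encode_fin]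
    · exact a.elim0
  · cases hb : c.bodd
    · simp only [cond_false]
      rw [List.getElem?_eq_none_iff]
      by_contra hlt
      simp only [List.length_ofFn, not_le] at hlt
      refine hc (.inl ⟨c.div2, hlt⟩) ?_
      have := Nat.bodd_add_div2 c
      rw [hb] at this
      simpa [encode_fin] using this
    · rfl

variable [hL : L.IsAlgebraic]

/-- The codes of the symbols of a formula. -/
noncomputable def formulaItems {n k : ℕ} (φ : L.BoundedFormula (Fin n) k) : List ℕ :=
  letI : IsEmpty (Σ l, L.Relations l) := ⟨fun r => (hL r.1).false r.2⟩
  letI : Encodable (Σ l, L.Relations l) := IsEmpty.toEncodable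
  φ.listEncode.map Encodable.encode

theorem formulaCode_eq {n : ℕ} (φ : L.Formula (Fin n)) :
    formulaCode φ = Encodable.encode (formulaItems φ) := by
  let : IsEmpty (Σ l, L.Relations l) := ⟨fun r => (hL r.1).false r.2⟩
  let : Encodable (Σ l, L.Relations l) := IsEmpty.toEncodable
  exact (encode_list_map _).symm

theorem formulaCode_injective {n : ℕ} :
    Function.Injective (formulaCode : L.Formula (Fin n) → ℕ) := by
  intro φ ψ h
  let : IsEmpty (Σ l, L.Relations l) := ⟨fun r => (hL r.1).false r.2⟩
  let : Encodable (Σ l, L.Relations l) := IsEmpty.toEncodable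
  have := Encodable.encode_injective h
  have := BoundedFormula.listEncode_sigma_injective
    (a₁ := (⟨0, φ⟩ : Σ k, L.BoundedFormula (Fin n) k)) (a₂ := ⟨0, ψ⟩) this
  simpa using this

/-- The code of a term, as a symbol of a formula, computed from the word of the term. -/
def termItem (w : List ℕ) : ℕ := 2 * Nat.pair 0 (Encodable.encode w)

/-- Logical symbols have codes `4 * k + 3`: implication is `k = 0`, and falsum without bound
variables is `k = 2`. Terms have even codes. -/
theorem formulaItems_falsum {n : ℕ} :
    formulaItems (.falsum : L.BoundedFormula (Fin n) 0) = [11] :=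
  rfl

theorem formulaItems_equal {n : ℕ} (t s : L.Term (Fin n ⊕ Fin 0)) :
    formulaItems (.equal t s) =
      [termItem (termWord Encodable.encode t), termItem (termWord Encodable.encode s)] := by
  rw [termItem, termItem, ← encode_term, ← encode_term]
  rfl

theorem formulaItems_imp {n : ℕ} (φ ψ : L.BoundedFormula (Fin n) 0) :
    formulaItems (φ.imp ψ) = 3 :: (formulaItems φ ++ formulaItems ψ) := by
  rw [formulaItems, BoundedFormula.listEncode, List.map_append]
  rfl

-- The condition `st.headI < 2` says that no right-hand side of an equation is waiting on the stack.
-- A finished subformula leaves a truth value `0` or `1`, which restores the condition; the empty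
-- stack meets it because `headI` then defaults to `0`.
open Classical in
theorem foldr_formulaStep_append (hop : ComputesOps L A op) {n : ℕ} (x : Fin n → A)
    (y : Fin 0 → A) {φ : L.BoundedFormula (Fin n) 0} (hφ : φ.IsQF) (st : List ℕ)
    (hst : st.headI < 2) :
    (formulaItems φ).foldr (formulaStep L op (List.ofFn fun i => (x i : ℕ))) st =
      (if φ.Realize x y then 1 else 0) :: st := by
  have hterm : ∀ (t : L.Term (Fin n ⊕ Fin 0)) (st : List ℕ),
      formulaStep L op (List.ofFn fun i => (x i : ℕ)) (termItem (termWord Encodable.encode t)) st =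
      bif decide (2 ≤ st.headI) then
        (bif decide (st.headI = (t.realize (Sum.elim x y) : A) + 2) then 1 else 0) :: st.tail
      else ((t.realize (Sum.elim x y) : A) + 2) :: st := by
    intro t st
    have h1 := stackRun_termWord_append (hop.isValuation_sum x y) t []
    rw [List.append_nil] at h1
    have h2 : (termItem (termWord Encodable.encode t)).div2.unpair.2 =
        Encodable.encode (termWord Encodable.encode t) := by
      simp [termItem, Nat.div2_val]
    have h3 : (termItem (termWord Encodable.encode t)).bodd = false := by simp [termItem]
    rw [formulaStep, h3, h2, Denumerable.ofNat_encode, h1]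
    rfl
  induction hφ generalizing st with
  | falsum => simp [formulaItems_falsum, formulaStep, BoundedFormula.Realize]
  | of_isAtomic h =>
    cases h with
    | equal t s =>
      have := formulaItems_equal t s
      rw [Term.bdEqual, this, List.foldr_cons, List.foldr_cons, List.foldr_nil, hterm, hterm]
      simp only [hst.not_ge, BoundedFormula.Realize, decide_false, cond_false, List.headI_cons,
        Nat.le_add_left, decide_true, cond_true, List.tail_cons, Nat.add_right_cancel_iff,
        ← Subtype.ext_iff, eq_comm (a := s.realize _), Bool.cond_decide]
      congr
    | rel R ts => exact ((hL _).false R).elim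
  | imp _ _ ih1 ih2 =>
    rw [formulaItems_imp, List.foldr_cons, List.foldr_append, ih2 _ hst, ih1]
    · simp only [formulaStep, BoundedFormula.Realize]
      split_ifs <;> simp_all
    · simp only [List.headI_cons]
      split_ifs <;> omega

open Classical in
theorem formulaValue_formulaCode (hop : ComputesOps L A op) {n : ℕ} (x : Fin n → A)
    {φ : L.Formula (Fin n)} (hφ : BoundedFormula.IsQF φ) :
    formulaValue L op (List.ofFn fun i => (x i : ℕ)) (formulaCode φ) = true ↔ φ.Realize x := by
  rw [formulaValue, formulaCode_eq, Denumerable.ofNat_encode, decide_eq_true_iff,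
    foldr_formulaStep_append hop x default hφ [] (by simp)]
  rw [Formula.Realize]
  split_ifs <;> simp_all

end Formulas

/-! ### Computable infinitary formulas as families of quantifier-free formulas -/

section Families

variable {L : FirstOrder.Language.{u, v}}

/-- A family of quantifier-free formulas `δ i (x, y)`, with `n` variables `x` and a number `len i` of
variables `y`. -/
structure QFFamily (L : FirstOrder.Language.{u, v}) (n : ℕ) where
  /-- The indices. -/
  ι : Type w
  /-- The number of additional variables. -/
  len : ι → ℕ
  /-- The formulas. -/
  form : ∀ i, L.Formula (Fin (n + len i))
  isQF : ∀ i, BoundedFormula.IsQF (form i)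

/-- The conjunction of the formulas `∀ y, δ i (x, y)`. -/
def QFFamily.RealizeAll {n : ℕ} (F : QFFamily.{u, v, w} L n) (B : Type) [L.Structure B]
    (x : Fin n → B) : Prop :=
  ∀ i, ∀ y : Fin (F.len i) → B, (F.form i).Realize (Fin.append x y)

/-- The disjunction of the formulas `∃ y, δ i (x, y)`. -/
def QFFamily.RealizeSome {n : ℕ} (F : QFFamily.{u, v, w} L n) (B : Type) [L.Structure B]
    (x : Fin n → B) : Prop :=
  ∃ i, ∃ y : Fin (F.len i) → B, (F.form i).Realize (Fin.append x y)

theorem fin_append_zero {n : ℕ} {B : Type} (x : Fin n → B) (y : Fin 0 → B) :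
    Fin.append x y = x := by
  funext i
  exact Fin.append_left x y i

/-- The family with one member, without additional variables. -/
def QFFamily.single {n : ℕ} (φ : L.Formula (Fin n)) (hφ : BoundedFormula.IsQF φ) :
    QFFamily.{u, v, 0} L n where
  ι := Unit
  len _ := 0
  form _ := φ
  isQF _ := hφ

theorem QFFamily.realizeAll_single {n : ℕ} (φ : L.Formula (Fin n)) (hφ : BoundedFormula.IsQF φ)
    {B : Type} [L.Structure B] (x : Fin n → B) :
    (QFFamily.single φ hφ).RealizeAll B x ↔ φ.Realize x :=
  ⟨fun h => fin_append_zero x (B := B) Fin.elim0 ▸ h () Fin.elim0,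
    fun h _ y => (fin_append_zero x y).symm ▸ h⟩

theorem QFFamily.realizeSome_single {n : ℕ} (φ : L.Formula (Fin n)) (hφ : BoundedFormula.IsQF φ)
    {B : Type} [L.Structure B] (x : Fin n → B) :
    (QFFamily.single φ hφ).RealizeSome B x ↔ φ.Realize x :=
  ⟨fun ⟨_, y, h⟩ => fin_append_zero x y ▸ h,
    fun h => ⟨(), Fin.elim0, (fin_append_zero x (B := B) Fin.elim0).symm ▸ h⟩⟩

variable [L.IsAlgebraic] [Encodable (Σ l, L.Functions l)]

/-- The family is computably enumerable. -/
def QFFamily.IsRE {n : ℕ} (F : QFFamily.{u, v, w} L n) : Prop :=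
  REPred fun k : ℕ => ∃ i, k = Nat.pair (F.len i) (formulaCode (F.form i))

theorem QFFamily.isRE_single {n : ℕ} (φ : L.Formula (Fin n)) (hφ : BoundedFormula.IsQF φ) :
    (QFFamily.single φ hφ).IsRE :=
  (rePred_eq Computable.id (Computable.const (Nat.pair 0 (formulaCode φ)))).of_eq fun k => by
    simp [single]

theorem HasIndex.exists_qf {s : Side} {α e n : ℕ} {φ : InfFormula L n} (h : HasIndex s α e φ)
    (hα : α < 1) : ∃ δ : L.Formula (Fin n), BoundedFormula.IsQF δ ∧ e = formulaCode δ ∧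
      φ = .finitary δ := by
  cases h with
  | qf s δ hδ => exact ⟨δ, hδ, rfl, rfl⟩
  | sigma h0 => omega
  | pi h0 => omega

/-- The family of the quantifier-free formulas with indices in a computably enumerable set. -/
def QFFamily.ofW {n : ℕ} (e : ℕ) (δ : (k : W e) → L.Formula (Fin (n + CompScott.len k)))
    (hδ : ∀ k, BoundedFormula.IsQF (δ k)) : QFFamily.{u, v, 0} L n where
  ι := W e
  len k := CompScott.len k
  form := δ
  isQF := hδ

theorem QFFamily.isRE_ofW {n : ℕ} {e : ℕ} {δ : (k : W e) → L.Formula (Fin (n + CompScott.len k))}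
    {hδ : ∀ k, BoundedFormula.IsQF (δ k)} (hidx : ∀ k : W e, idx k = formulaCode (δ k)) :
    (QFFamily.ofW e δ hδ).IsRE := by
  have hu : Computable fun p : ℕ × ℕ => p.2.unpair.2 :=
    Computable.snd.comp (Computable.unpair.comp Computable.snd)
  have : REPred fun j : ℕ => ∃ k, k ∈ W e ∧ j = k.unpair.2 :=
    REPred.exists ((rePred_mem_W.comp ((Computable.const e).pair Computable.snd)).and
      (rePred_eq Computable.fst hu))
  refine this.of_eq fun j => ?_
  constructor
  · rintro ⟨k, hk, rfl⟩
    refine ⟨⟨k, hk⟩, ?_⟩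
    have := hidx ⟨k, hk⟩
    simp only [ofW]
    rw [← this]
    simp [CompScott.len, idx]
  · rintro ⟨⟨k, hk⟩, rfl⟩
    refine ⟨k, hk, ?_⟩
    have := hidx ⟨k, hk⟩
    simp only [ofW]
    rw [← this]
    simp [CompScott.len, idx]

theorem HasIndex.exists_family_pi {α e n : ℕ} {φ : InfFormula L n} (h : HasIndex .pi α e φ)
    (hα : α < 2) : ∃ F : QFFamily.{u, v, 0} L n, F.IsRE ∧
      ∀ (B : Type) [L.Structure B] (x : Fin n → B), φ.Realize B x ↔ F.RealizeAll B x := by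
  cases h with
  | qf s δ hδ =>
    exact ⟨.single δ hδ, QFFamily.isRE_single δ hδ, fun B _ x => by
      rw [QFFamily.realizeAll_single]; rfl⟩
  | pi h0 ψ hlt h =>
    choose δ h1 h2 h3 using fun k => (h k).exists_qf (by have := hlt k; omega)
    refine ⟨.ofW e δ h1, QFFamily.isRE_ofW h2, fun B _ x => ?_⟩
    simp only [InfFormula.Realize, h3]
    rfl

theorem HasIndex.exists_family_sigma {α e n : ℕ} {φ : InfFormula L n} (h : HasIndex .sigma α e φ)
    (hα : α < 2) : ∃ F : QFFamily.{u, v, 0} L n, F.IsRE ∧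
      ∀ (B : Type) [L.Structure B] (x : Fin n → B), φ.Realize B x ↔ F.RealizeSome B x := by
  cases h with
  | qf s δ hδ =>
    exact ⟨.single δ hδ, QFFamily.isRE_single δ hδ, fun B _ x => by
      rw [QFFamily.realizeSome_single]; rfl⟩
  | sigma h0 ψ hlt h =>
    choose δ h1 h2 h3 using fun k => (h k).exists_qf (by have := hlt k; omega)
    refine ⟨.ofW e δ h1, QFFamily.isRE_ofW h2, fun B _ x => ?_⟩
    simp only [InfFormula.Realize, h3]
    rfl

/-- Enumerability is kept for each disjunct because the forcing starts from the `Π₁` matrix of a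
disjunct true in `A`, which must be co-c.e. From the `Π₂` part only countability will be needed. -/
theorem HasIndex.exists_families_sigma_two {e n : ℕ} {φ : InfFormula L n}
    (h : HasIndex .sigma 2 e φ) : ∃ (ι : Type) (m : ι → ℕ) (F : ∀ i, QFFamily.{u, v, 0} L (n + m i)),
      (∀ i, (F i).IsRE) ∧ ∀ (B : Type) [L.Structure B] (x : Fin n → B),
        φ.Realize B x ↔ ∃ i, ∃ y : Fin (m i) → B, (F i).RealizeAll B (Fin.append x y) := by
  cases h with
  | sigma h0 ψ hlt h =>
    choose F h1 h2 using fun k => (h k).exists_family_pi (hlt k)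
    refine ⟨W e, fun k => len k, F, h1, fun B _ x => ?_⟩
    simp only [InfFormula.Realize, h2]

theorem HasIndex.exists_families_pi_two {e n : ℕ} {φ : InfFormula L n}
    (h : HasIndex .pi 2 e φ) : ∃ (ι : Type) (m : ι → ℕ) (F : ∀ i, QFFamily.{u, v, 0} L (n + m i)),
      Countable ι ∧ ∀ (B : Type) [L.Structure B] (x : Fin n → B),
        φ.Realize B x ↔ ∀ i, ∀ y : Fin (m i) → B, (F i).RealizeSome B (Fin.append x y) := by
  cases h with
  | pi h0 ψ hlt h =>
    choose F h1 h2 using fun k => (h k).exists_family_sigma (hlt k)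
    refine ⟨W e, fun k => len k, F, inferInstance, fun B _ x => ?_⟩
    simp only [InfFormula.Realize, h2]

variable {n : ℕ}

theorem QFFamily.IsRE.exists_W {F : QFFamily.{u, v, w} L n} (hF : F.IsRE) :
    ∃ e, ∀ k, k ∈ W e ↔ ∃ i, k = Nat.pair 0 (Nat.pair (F.len i) (formulaCode (F.form i))) := by
  have hu : Computable fun p : ℕ × ℕ => Nat.pair 0 p.2 :=
    Primrec₂.natPair.to_comp.comp (Computable.const 0) Computable.snd
  have : REPred fun k : ℕ => ∃ j, (∃ i, j = Nat.pair (F.len i) (formulaCode (F.form i))) ∧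
      k = Nat.pair 0 j :=
    REPred.exists ((REPred.comp hF Computable.snd).and (rePred_eq Computable.fst hu))
  obtain ⟨e, he⟩ := exists_W_eq this
  refine ⟨e, fun k => ?_⟩
  rw [he]
  constructor
  · rintro ⟨_, ⟨i, rfl⟩, rfl⟩
    exact ⟨i, rfl⟩
  · rintro ⟨i, rfl⟩
    exact ⟨_, ⟨i, rfl⟩, rfl⟩

/-- The type of a formula with index `k` mentions `len k`, which equals `F.len i` only
propositionally, hence the transport. Several `i` may share an index `k`; injectivity of
`formulaCode`, used in `formula_of_index`, makes the choice of `i` harmless. -/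
theorem QFFamily.exists_form_of_mem {F : QFFamily.{u, v, w} L n} {k : ℕ}
    (hk : ∃ i, k = Nat.pair 0 (Nat.pair (F.len i) (formulaCode (F.form i)))) :
    ∃ δ : L.Formula (Fin (n + CompScott.len k)), BoundedFormula.IsQF δ ∧ lvl k = 0 ∧
      idx k = formulaCode δ ∧ (∀ (B : Type) [L.Structure B] (x : Fin n → B),
        F.RealizeAll B x → ∀ y, δ.Realize (Fin.append x y)) ∧
      (∀ (B : Type) [L.Structure B] (x : Fin n → B),
        (∃ y, δ.Realize (Fin.append x y)) → F.RealizeSome B x) := by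
  obtain ⟨i, rfl⟩ := hk
  have hlen : F.len i = CompScott.len (Nat.pair 0 (Nat.pair (F.len i) (formulaCode (F.form i)))) := by
    simp [CompScott.len]
  have hidx : idx (Nat.pair 0 (Nat.pair (F.len i) (formulaCode (F.form i)))) =
      formulaCode (F.form i) := by simp [idx]
  have hlvl : lvl (Nat.pair 0 (Nat.pair (F.len i) (formulaCode (F.form i)))) = 0 := by simp [lvl]
  have h1 : ∀ (B : Type) [L.Structure B] (x : Fin n → B),
        F.RealizeAll B x → ∀ y, (F.form i).Realize (Fin.append x y) := fun B _ x h => h i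
  have h2 : ∀ (B : Type) [L.Structure B] (x : Fin n → B),
        (∃ y, (F.form i).Realize (Fin.append x y)) → F.RealizeSome B x := fun B _ x h => ⟨i, h⟩
  have h3 := F.isQF i
  generalize F.form i = δ at *
  generalize Nat.pair 0 (Nat.pair (F.len i) (formulaCode δ)) = k at *
  generalize F.len i = l at *
  subst hlen
  exact ⟨δ, h3, hlvl, hidx, h1, h2⟩

theorem formula_of_index {l : ℕ} {δ : L.Formula (Fin (n + l))} {k : ℕ}
    (hk : k = Nat.pair 0 (Nat.pair l (formulaCode δ)))
    {δ' : L.Formula (Fin (n + CompScott.len k))} (hδ' : idx k = formulaCode δ') {B : Type}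
    [L.Structure B] {x : Fin n → B} :
    ((∀ y, δ'.Realize (Fin.append x y)) → ∀ y, δ.Realize (Fin.append x y)) ∧
      ((∃ y, δ.Realize (Fin.append x y)) → ∃ y, δ'.Realize (Fin.append x y)) := by
  have hlen : CompScott.len k = l := by simp [hk, CompScott.len]
  have hidx : idx k = formulaCode δ := by simp [hk, idx]
  rw [hδ'] at hidx
  clear hδ' hk
  generalize CompScott.len k = l' at *
  subst hlen
  rw [formulaCode_injective hidx]
  exact ⟨id, id⟩

theorem QFFamily.IsRE.exists_hasIndex_pi {F : QFFamily.{u, v, w} L n} (hF : F.IsRE) :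
    ∃ (e : ℕ) (φ : InfFormula L n), HasIndex .pi 1 e φ ∧
      ∀ (B : Type) [L.Structure B] (x : Fin n → B), φ.Realize B x ↔ F.RealizeAll B x := by
  obtain ⟨e, he⟩ := hF.exists_W
  choose δ h1 h2 h3 h4 h5 using fun k : W e => QFFamily.exists_form_of_mem ((he k).1 k.2)
  refine ⟨e, _, HasIndex.pi (n := n) one_pos (fun k => .finitary (δ k))
    (fun k => by rw [h2 k]; exact one_pos) (fun k => ?_), fun B _ x => ?_⟩
  · rw [h2 k, h3 k]
    exact .qf _ _ (h1 k)
  · simp only [InfFormula.Realize]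
    constructor
    · intro h i
      obtain ⟨k, hk⟩ : ∃ k : W e, (k : ℕ) =
          Nat.pair 0 (Nat.pair (F.len i) (formulaCode (F.form i))) :=
        ⟨⟨_, (he _).2 ⟨i, rfl⟩⟩, rfl⟩
      exact (formula_of_index hk (h3 k)).1 (h k)
    · intro h k
      exact h4 k B x h

theorem QFFamily.IsRE.exists_hasIndex_sigma {F : QFFamily.{u, v, w} L n} (hF : F.IsRE) :
    ∃ (e : ℕ) (φ : InfFormula L n), HasIndex .sigma 1 e φ ∧
      ∀ (B : Type) [L.Structure B] (x : Fin n → B), φ.Realize B x ↔ F.RealizeSome B x := by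
  obtain ⟨e, he⟩ := hF.exists_W
  choose δ h1 h2 h3 h4 h5 using fun k : W e => QFFamily.exists_form_of_mem ((he k).1 k.2)
  refine ⟨e, _, HasIndex.sigma (n := n) one_pos (fun k => .finitary (δ k))
    (fun k => by rw [h2 k]; exact one_pos) (fun k => ?_), fun B _ x => ?_⟩
  · rw [h2 k, h3 k]
    exact .qf _ _ (h1 k)
  · simp only [InfFormula.Realize]
    constructor
    · rintro ⟨k, h⟩
      exact h5 k B x h
    · rintro ⟨i, h⟩
      obtain ⟨k, hk⟩ : ∃ k : W e, (k : ℕ) =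
          Nat.pair 0 (Nat.pair (F.len i) (formulaCode (F.form i))) :=
        ⟨⟨_, (he _).2 ⟨i, rfl⟩⟩, rfl⟩
      exact ⟨k, (formula_of_index hk (h3 k)).2 h⟩

theorem exists_formula_of_eq_pair {s : Side} {α e m k : ℕ} {φ : InfFormula L (n + m)}
    (hφ : HasIndex s α e φ) (hk : k = Nat.pair α (Nat.pair m e)) :
    ∃ ψ : InfFormula L (n + len k), HasIndex s (lvl k) (idx k) ψ ∧
      ∀ (B : Type) [L.Structure B] (x : Fin n → B),
        ((∃ y, ψ.Realize B (Fin.append x y)) ↔ ∃ y, φ.Realize B (Fin.append x y)) ∧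
        ((∀ y, ψ.Realize B (Fin.append x y)) ↔ ∀ y, φ.Realize B (Fin.append x y)) := by
  have h1 : lvl k = α := by simp [hk, lvl]
  have h2 : len k = m := by simp [hk, len]
  have h3 : idx k = e := by simp [hk, idx]
  rw [h1, h3]
  clear h1 h3 hk
  generalize len k = m' at *
  subst h2
  exact ⟨φ, hφ, fun B _ x => ⟨Iff.rfl, Iff.rfl⟩⟩

/-- A single quantified formula is the disjunction over a one-element c.e. set of indices. -/
theorem HasIndex.exists_isComputableSigma_ex {α e m : ℕ} {φ : InfFormula L (n + m)}
    (hφ : HasIndex .pi α e φ) : ∃ ψ : InfFormula L n, IsComputableSigma (α + 1) ψ ∧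
      ∀ (B : Type) [L.Structure B] (x : Fin n → B),
        ψ.Realize B x ↔ ∃ y, φ.Realize B (Fin.append x y) := by
  obtain ⟨e', he'⟩ := exists_W_eq (S := {Nat.pair α (Nat.pair m e)})
    (rePred_eq Computable.id (Computable.const _))
  have hmem : ∀ k : W e', (k : ℕ) = Nat.pair α (Nat.pair m e) := fun k => he'.subset k.2
  choose ψ h1 h2 using fun k : W e' => exists_formula_of_eq_pair hφ (hmem k)
  refine ⟨_, ⟨e', HasIndex.sigma (n := n) α.succ_pos ψ (fun k => ?_) h1⟩, fun B _ x => ?_⟩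
  · rw [hmem k]
    simp [lvl]
  · simp only [InfFormula.Realize, fun k => (h2 k B x).1]
    exact ⟨fun ⟨_, h⟩ => h, fun h => ⟨⟨_, he'.superset rfl⟩, h⟩⟩

theorem HasIndex.exists_isComputablePi_all {α e m : ℕ} {φ : InfFormula L (n + m)}
    (hφ : HasIndex .sigma α e φ) : ∃ ψ : InfFormula L n, IsComputablePi (α + 1) ψ ∧
      ∀ (B : Type) [L.Structure B] (x : Fin n → B),
        ψ.Realize B x ↔ ∀ y, φ.Realize B (Fin.append x y) := by
  obtain ⟨e', he'⟩ := exists_W_eq (S := {Nat.pair α (Nat.pair m e)})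
    (rePred_eq Computable.id (Computable.const _))
  have hmem : ∀ k : W e', (k : ℕ) = Nat.pair α (Nat.pair m e) := fun k => he'.subset k.2
  choose ψ h1 h2 using fun k : W e' => exists_formula_of_eq_pair hφ (hmem k)
  refine ⟨_, ⟨e', HasIndex.pi (n := n) α.succ_pos ψ (fun k => ?_) h1⟩, fun B _ x => ?_⟩
  · rw [hmem k]
    simp [lvl]
  · simp only [InfFormula.Realize, fun k => (h2 k B x).2]
    exact ⟨fun h => h ⟨_, he'.superset rfl⟩, fun h _ => h⟩

end Families

/-! ### Limits of structures generated by sequences -/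

section Limit

variable {L : FirstOrder.Language.{u, v}}

theorem exists_relabel_fin (t : L.Term ℕ) :
    ∃ j₀, ∀ j ≥ j₀, ∃ t' : L.Term (Fin j), t = t'.relabel fun i : Fin j => (i : ℕ) := by
  induction t with
  | var a => exact ⟨a + 1, fun j hj => ⟨.var ⟨a, hj⟩, rfl⟩⟩
  | func f ts ih =>
    choose j₀ h using ih
    refine ⟨Finset.univ.sup j₀, fun j hj => ?_⟩
    choose t' ht' using fun i => h i j ((Finset.le_sup (Finset.mem_univ i)).trans hj)
    exact ⟨.func f t', by simp [Term.relabel, ← ht']⟩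

theorem exists_relabel_fin_tuple {m : ℕ} (t : Fin m → L.Term ℕ) :
    ∃ (j : ℕ) (t' : Fin m → L.Term (Fin j)), ∀ i, t i = (t' i).relabel fun i : Fin j => (i : ℕ) := by
  choose j₀ h using fun i => exists_relabel_fin (t i)
  choose t' ht' using fun i => h i (Finset.univ.sup j₀) (Finset.le_sup (Finset.mem_univ i))
  exact ⟨_, t', ht'⟩

/-- The substructure of an ultrapower of `A` generated by a sequence of elements satisfies each
quantifier-free formula that holds eventually in the sequence of representatives. -/
theorem exists_limit_structure [Countable (Σ l, L.Functions l)] {A : Type} [L.Structure A]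
    [Nonempty A] (e : ℕ → ℕ → A) :
    ∃ (B : Type) (_ : L.Structure B) (b : ℕ → B), Countable B ∧
      (∀ z, ∃ t : L.Term ℕ, t.realize b = z) ∧
      ∀ {k : ℕ} (δ : L.Formula (Fin k)), BoundedFormula.IsQF δ → ∀ t : Fin k → L.Term ℕ,
        (∃ s, ∀ r ≥ s, δ.Realize fun i => (t i).realize (e r)) →
          δ.Realize fun i => (t i).realize b := by
  let U : Ultrafilter ℕ := Filter.hyperfilter ℕ
  let b' : ℕ → (U : Filter ℕ).Product fun _ : ℕ => A :=
    fun i => ((fun r => e r i : ℕ → A) : (U : Filter ℕ).Product fun _ : ℕ => A)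
  let S : L.Substructure ((U : Filter ℕ).Product fun _ : ℕ => A) :=
    Substructure.closure L (Set.range b')
  let b : ℕ → S := fun i => ⟨b' i, Substructure.subset_closure ⟨i, rfl⟩⟩
  have hb : ∀ t : L.Term ℕ, S.subtype (t.realize b) = t.realize b' := fun t =>
    (HomClass.realize_term S.subtype).symm
  refine ⟨S, inferInstance, b, ?_, ?_, ?_⟩
  · exact Substructure.cg_iff_countable.1 ⟨_, Set.countable_range b', rfl⟩
  · rintro ⟨z, hz⟩
    obtain ⟨t, ht⟩ := mem_closure_range_iff.1 hz
    exact ⟨t, Subtype.ext ((hb t).trans ht)⟩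
  · rintro k δ hδ t ⟨s, hs⟩
    have h1 : ∀ᶠ r in (U : Filter ℕ), δ.Realize fun i => (t i).realize (e r) := by
      refine Filter.Tendsto.eventually (f := id) ?_ (Filter.eventually_atTop.2 ⟨s, hs⟩)
      rw [Filter.tendsto_id']
      exact Nat.hyperfilter_le_atTop
    have h2 := (Ultraproduct.realize_formula_cast δ fun i r => (t i).realize (e r)).2 h1
    have h3 : (fun i => (((fun r => (t i).realize (e r) : ℕ → A)) :
        (U : Filter ℕ).Product fun _ : ℕ => A)) = fun i => S.subtype ((t i).realize b) := by
      funext i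
      rw [hb]
      exact (Ultraproduct.term_realize_cast (fun i r => e r i) (t i)).symm
    rw [h3] at h2
    -- Łoś's theorem gives truth in the ultrapower; being quantifier-free, `δ` passes down to the
    -- substructure.
    have h4 := hδ.realize_embedding S.subtype (v := fun i => (t i).realize b) (xs := default)
    rw [Subsingleton.elim (⇑S.subtype ∘ default : Fin 0 → _) default] at h4
    exact h4.1 h2

end Limit

/-! ### Forcing with co-computably enumerable conditions -/

section Forcing

theorem take_ofFn_coe {α β : Type*} (c : α → β) (e : ℕ → α) {n N : ℕ} (h : n ≤ N) :
    (List.ofFn fun i : Fin N => c (e i)).take n = List.ofFn fun i : Fin n => c (e i) := by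
  apply List.ext_getElem
  · simp [h]
  · intro i h1 h2
    simp

theorem drop_ofFn_coe {α β : Type*} (c : α → β) (e : ℕ → α) (N l : ℕ) :
    (List.ofFn fun i : Fin (N + l) => c (e i)).drop N = List.ofFn fun i : Fin l => c (e (N + i)) := by
  apply List.ext_getElem
  · simp
  · intro i h1 h2
    simp

theorem ofFn_append_coe {α β : Type*} (c : α → β) {m n : ℕ} (x : Fin m → α) (y : Fin n → α) :
    (List.ofFn fun i => c (Fin.append x y i)) =
      (List.ofFn fun i => c (x i)) ++ List.ofFn fun i => c (y i) := by
  have h := congrArg (List.map c) (List.ofFn_fin_append x y)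
  rw [List.map_append, List.map_ofFn, List.map_ofFn, List.map_ofFn] at h
  exact h

variable {L : FirstOrder.Language.{u, v}} {A : Set ℕ} [L.Structure A]

/-- A set of sequences is basic if it is the complement of a computably enumerable condition on the
first `n` terms, and invariant under automorphisms. -/
def IsBasic (L : FirstOrder.Language.{u, v}) {A : Set ℕ} [L.Structure A] (P : Set (ℕ → A)) (n : ℕ) :
    Prop :=
  ∃ Q : List ℕ → Prop, REPred Q ∧
    (∀ e : ℕ → A, e ∈ P ↔ ¬ Q (List.ofFn fun i : Fin n => (e i : ℕ))) ∧
    ∀ (g : A ≃[L] A) (e : ℕ → A), e ∈ P → (fun i => g (e i)) ∈ P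

theorem IsBasic.mono {P : Set (ℕ → A)} {n N : ℕ} (hP : IsBasic L P n) (h : n ≤ N) :
    IsBasic L P N := by
  obtain ⟨Q, hQ, hPQ, hg⟩ := hP
  refine ⟨fun l => Q (l.take n), ?_, fun e => ?_, hg⟩
  · exact hQ.comp (Primrec.list_take.to_comp.comp (Computable.const n) Computable.id)
  · beta_reduce
    rw [hPQ e, take_ofFn_coe (fun a : A => (a : ℕ)) e h]

theorem IsBasic.inter {P P' : Set (ℕ → A)} {n : ℕ} (hP : IsBasic L P n) (hP' : IsBasic L P' n) :
    IsBasic L (P ∩ P') n := by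
  obtain ⟨Q, hQ, hPQ, hg⟩ := hP
  obtain ⟨Q', hQ', hPQ', hg'⟩ := hP'
  refine ⟨fun l => Q l ∨ Q' l, hQ.or hQ', fun e => ?_, fun g e he => ⟨hg g e he.1, hg' g e he.2⟩⟩
  rw [Set.mem_inter_iff, hPQ, hPQ', not_or]

theorem IsBasic.congr {P : Set (ℕ → A)} {n : ℕ} (hP : IsBasic L P n) {e e' : ℕ → A}
    (h : ∀ i < n, e i = e' i) (he : e ∈ P) : e' ∈ P := by
  obtain ⟨Q, hQ, hPQ, hg⟩ := hP
  rw [hPQ] at he ⊢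
  have : (fun i : Fin n => (e' i : ℕ)) = fun i : Fin n => (e i : ℕ) :=
    funext fun i => by rw [h i i.2]
  rwa [this]

theorem realize_equiv_comp {B : Type} [L.Structure B] {k : ℕ} (δ : L.Formula (Fin k)) (g : B ≃[L] B)
    (x : Fin k → B) : (δ.Realize fun i => g (x i)) ↔ δ.Realize x :=
  StrongHomClass.realize_formula g δ

theorem append_equiv {B : Type} [L.Structure B] {m n : ℕ} (g : B ≃[L] B) (x : Fin m → B)
    (y : Fin n → B) :
    (Fin.append (fun i => g (x i)) fun i => g (y i)) = fun i => g (Fin.append x y i) := by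
  funext i
  refine Fin.addCases (fun i => ?_) (fun i => ?_) i <;> simp

variable [Encodable (Σ l, L.Functions l)] [Finite (Σ l, L.Functions l)] {op : ℕ → List ℕ → ℕ}

theorem isBasic_notMem_closure (hop : ComputesOps L A op) (N : ℕ) :
    IsBasic L {e : ℕ → A | e N ∉ Substructure.closure L (Set.range fun i : Fin N => e i)} (N + 1) := by
  refine ⟨fun l => ∃ w, (evalWord L op (l.take N) w).head? = l[N]?, ?_, fun e => ?_,
    fun g e he => ?_⟩
  · refine REPred.exists (rePred_eq ?_ ?_)
    · exact Primrec.list_head?.to_comp.comp ((computable_evalWord hop.computable).comp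
        (Primrec.list_take.to_comp.comp (Computable.const N) Computable.fst) Computable.snd)
    · exact Computable.list_getElem?.comp Computable.fst (Computable.const N)
  · beta_reduce
    rw [Set.mem_ofPred_eq, mem_closure_range_iff_evalWord hop,
      take_ofFn_coe (fun a : A => (a : ℕ)) e N.le_succ, List.getElem?_ofFn, dif_pos N.lt_succ_self]
  · rw [Set.mem_ofPred_eq, mem_closure_range_iff] at he ⊢
    rintro ⟨t, ht⟩
    refine he ⟨t, g.injective ?_⟩
    exact (HomClass.realize_term g).symm.trans ht

/-- The conditions, stronger conditions being larger. -/
abbrev Condition (L : FirstOrder.Language.{u, v}) (A : Set ℕ) [L.Structure A] :=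
  {P : (Set (ℕ → A))ᵒᵈ // (OrderDual.ofDual P).Nonempty ∧ ∃ N, IsBasic L (OrderDual.ofDual P) N}

/-- A condition on the first `N` terms leaves term `N` free. If some member's first `N` terms do not
generate, an element outside their closure can be put there. -/
theorem isCofinal_notMem_closure (hop : ComputesOps L A op)
    (h : ∀ (P : Set (ℕ → A)) (N : ℕ), IsBasic L P N → P.Nonempty →
      ∃ e ∈ P, ¬ Generates L fun i : Fin N => e i) (j : ℕ) :
    IsCofinal {p : Condition L A | ∃ N ≥ j, ∀ e ∈ OrderDual.ofDual p.1,
      e N ∉ Substructure.closure L (Set.range fun i : Fin N => e i)} := by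
  rintro ⟨P, hP, N₀, hN₀⟩
  obtain ⟨N, h1, h2⟩ : ∃ N, N₀ ≤ N ∧ j ≤ N := ⟨max N₀ j, le_max_left _ _, le_max_right _ _⟩
  have hN := hN₀.mono h1
  obtain ⟨e, he, hgen⟩ := h _ N hN hP
  have : ∃ z, z ∉ Substructure.closure L (Set.range fun i : Fin N => e i) := by
    by_contra! hz
    exact hgen (eq_top_iff.2 fun z _ => hz z)
  obtain ⟨z, hz⟩ := this
  have heq : ∀ i < N, e i = Function.update e N z i := fun i hi => by
    rw [Function.update_of_ne hi.ne]
  refine ⟨⟨OrderDual.toDual (OrderDual.ofDual P ∩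
    {e | e N ∉ Substructure.closure L (Set.range fun i : Fin N => e i)}),
    ⟨Function.update e N z, hN.congr heq he, ?_⟩, N + 1,
    (hN.mono N.le_succ).inter (isBasic_notMem_closure hop N)⟩, ⟨N, h2, fun e he => he.2⟩,
    fun e he => he.1⟩
  have : (fun i : Fin N => Function.update e N z i) = fun i : Fin N => e i :=
    funext fun i => (heq i i.2).symm
  rw [Set.mem_ofPred_eq, this, Function.update_self]
  exact hz

variable [L.IsAlgebraic]

theorem isBasic_realize (hop : ComputesOps L A op) {m l j N : ℕ} {δ : L.Formula (Fin (m + l))}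
    (hδ : BoundedFormula.IsQF δ) (t : Fin m → L.Term (Fin j)) (hj : j ≤ N) :
    IsBasic L {e : ℕ → A | δ.Realize (Fin.append (fun i => (t i).realize fun a : Fin j => e a)
      fun i : Fin l => e (N + i))} (N + l) := by
  refine ⟨fun x => ¬ formulaValue L op (evalWord L op (x.take j)
    ((List.ofFn t).flatMap (termWord fun i : Fin j => (i : ℕ))) ++ x.drop N) (formulaCode δ) = true,
    ?_, fun e => ?_, fun g e he => ?_⟩
  · refine REPred.ne_true ((computable_formulaValue hop.computable).comp ?_ (Computable.const _))
    exact Computable.list_append.comp ((computable_evalWord hop.computable).comp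
      (Primrec.list_take.to_comp.comp (Computable.const j) Computable.id) (Computable.const _))
      (Primrec.list_drop.to_comp.comp (Computable.const N) Computable.id)
  · rw [Set.mem_ofPred_eq, not_not, take_ofFn_coe (fun a : A => (a : ℕ)) e (by omega),
      drop_ofFn_coe (fun a : A => (a : ℕ)) e, evalWord_flatMap hop (fun a : Fin j => e a),
      List.map_ofFn, ← formulaValue_formulaCode hop _ hδ,
      ofFn_append_coe (fun a : A => (a : ℕ))]
    rfl
  · rw [Set.mem_ofPred_eq] at he ⊢
    have : (fun i => (t i).realize fun a : Fin j => g (e a)) =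
        fun i => g ((t i).realize fun a : Fin j => e a) :=
      funext fun i => HomClass.realize_term g
    rw [this, append_equiv, realize_equiv_comp]
    exact he

/-- Failure of a `Π₁` condition is found by searching for a member of the family and a tuple from
`A` that refutes it. -/
theorem QFFamily.IsRE.exists_rePred {n : ℕ} {F : QFFamily.{u, v, w} L n} (hF : F.IsRE)
    (hA : ComputablePred fun k => k ∈ A) (hop : ComputesOps L A op) :
    ∃ Q : List ℕ → Prop, REPred Q ∧
      ∀ x : Fin n → A, F.RealizeAll A x ↔ ¬ Q (List.ofFn fun i => (x i : ℕ)) := by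
  obtain ⟨f, hf, hfA⟩ := ComputablePred.computable_iff.1 hA
  have hfA' : ∀ k, k ∈ A ↔ f k = true := fun k => iff_of_eq (congrFun hfA k)
  refine ⟨fun l => ∃ q : ℕ × List ℕ, (∃ i, q.1 = Nat.pair (F.len i) (formulaCode (F.form i))) ∧
    q.2.length = q.1.unpair.1 ∧ q.2.all f = true ∧
      ¬ formulaValue L op (l ++ q.2) q.1.unpair.2 = true, ?_, fun x => ?_⟩
  · have h1 : Computable fun p : List ℕ × ℕ × List ℕ => p.2.1 :=
      Computable.fst.comp Computable.snd
    have h2 : Computable fun p : List ℕ × ℕ × List ℕ => p.2.2 :=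
      Computable.snd.comp Computable.snd
    have h3 := Computable.unpair.comp h1
    refine REPred.exists ((REPred.comp hF h1).and (REPred.and ?_ (REPred.and ?_ ?_)))
    · exact rePred_eq (Computable.list_length.comp h2) (Computable.fst.comp h3)
    · exact rePred_eq_true (computable_list_all h2 (hf.comp Computable.snd))
    · exact REPred.ne_true ((computable_formulaValue hop.computable).comp
        (Computable.list_append.comp Computable.fst h2) (Computable.snd.comp h3))
  · constructor
    · rintro h ⟨⟨_, y⟩, ⟨i, rfl⟩, hlen, hy, hv⟩
      simp only [Nat.unpair_pair] at hlen hv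
      simp only [List.all_eq_true] at hy
      let y' : Fin (F.len i) → A := fun j =>
        ⟨y[j], (hfA' _).2 (hy _ (List.getElem_mem _))⟩
      have hyy : y = List.ofFn fun j => (y' j : ℕ) := by
        apply List.ext_getElem
        · simp [hlen]
        · intro j h1 h2
          simp [y']
      refine hv ?_
      rw [hyy, ← ofFn_append_coe (fun a : A => (a : ℕ)),
        formulaValue_formulaCode hop _ (F.isQF i)]
      exact h i y'
    · intro h i y
      by_contra hv
      refine h ⟨(Nat.pair (F.len i) (formulaCode (F.form i)), List.ofFn fun j => (y j : ℕ)),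
        ⟨i, rfl⟩, by simp, ?_, ?_⟩
      · simp only [List.all_eq_true, List.mem_ofFn]
        rintro _ ⟨j, rfl⟩
        exact (hfA' _).1 (y j).2
      · rw [← ofFn_append_coe (fun a : A => (a : ℕ))]
        simpa [formulaValue_formulaCode hop _ (F.isQF i)] using hv

theorem isBasic_realizeAll {n : ℕ} {F : QFFamily.{u, v, w} L n} (hF : F.IsRE)
    (hA : ComputablePred fun k => k ∈ A) (hop : ComputesOps L A op) :
    IsBasic L {e : ℕ → A | F.RealizeAll A fun i : Fin n => e i} n := by
  obtain ⟨Q, hQ, h⟩ := hF.exists_rePred hA hop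
  refine ⟨Q, hQ, fun e => h _, fun g e he i y => ?_⟩
  have h1 : y = fun i => g (g.symm (y i)) := funext fun i => (g.apply_symm_apply _).symm
  rw [h1, append_equiv g (fun i : Fin n => e i), realize_equiv_comp]
  exact he i _

/-- Witnesses from `A` are written into the positions from `N` on, which the condition leaves free,
so in the limit they are named by terms of the sequence. -/
theorem isCofinal_realizeSome (hop : ComputesOps L A op) {m : ℕ} (F : QFFamily.{u, v, w} L m)
    (hF : ∀ y, F.RealizeSome A y) {j : ℕ} (t : Fin m → L.Term (Fin j)) :
    IsCofinal {p : Condition L A | ∃ (i : F.ι) (N : ℕ), ∀ e ∈ OrderDual.ofDual p.1,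
      (F.form i).Realize (Fin.append (fun i => (t i).realize fun a : Fin j => e a)
        fun k : Fin (F.len i) => e (N + k))} := by
  rintro ⟨P, hP, N₀, hN₀⟩
  obtain ⟨N, h1, h2⟩ : ∃ N, N₀ ≤ N ∧ j ≤ N := ⟨max N₀ j, le_max_left _ _, le_max_right _ _⟩
  have hN := hN₀.mono h1
  obtain ⟨e, he⟩ := hP
  obtain ⟨i, y, hy⟩ := hF fun i => (t i).realize fun a : Fin j => e a
  let e' : ℕ → A := fun a => if h : a - N < F.len i ∧ N ≤ a then y ⟨a - N, h.1⟩ else e a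
  have heq : ∀ a < N, e a = e' a := fun a ha => by
    simp only [e']
    rw [dif_neg]
    omega
  have hy' : (fun k : Fin (F.len i) => e' (N + k)) = y := by
    funext k
    simp [e']
  refine ⟨⟨OrderDual.toDual (OrderDual.ofDual P ∩ {e | (F.form i).Realize
    (Fin.append (fun i => (t i).realize fun a : Fin j => e a)
        fun k : Fin (F.len i) => e (N + k))}), ⟨e', hN.congr heq he, ?_⟩, N + F.len i,
    (hN.mono (Nat.le_add_right _ _)).inter (isBasic_realize hop (F.isQF i) t h2)⟩,
    ⟨i, N, fun e he => he.2⟩, fun e he => he.1⟩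
  have : (fun a : Fin j => e' a) = fun a : Fin j => e a :=
    funext fun a => (heq a (a.2.trans_le h2)).symm
  rw [Set.mem_ofPred_eq, hy', this]
  exact hy

/-- Otherwise both kinds of requirement are cofinal, and a sequence of conditions meeting all of
them produces a countable model of the `Π₁` matrix and the `Π₂` part with no finite generating
tuple, against `hB`. -/
theorem exists_isBasic_generates [Nonempty A] (hA : ComputablePred fun k => k ∈ A)
    (hop : ComputesOps L A op) {n : ℕ} {F₀ : QFFamily.{u, v, 0} L n} (hF₀ : F₀.IsRE)
    {x₀ : Fin n → A} (hx₀ : F₀.RealizeAll A x₀) {ι : Type} [Countable ι] {m : ι → ℕ}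
    {F : ∀ i, QFFamily.{u, v, 0} L (m i)} (hF : ∀ i y, (F i).RealizeSome A y)
    (hB : ∀ (B : Type) [L.Structure B] [Countable B] (x : Fin n → B), F₀.RealizeAll B x →
      (∀ i y, (F i).RealizeSome B y) → ∃ (k : ℕ) (b : Fin k → B), Generates L b) :
    ∃ (P : Set (ℕ → A)) (N : ℕ), IsBasic L P N ∧ P.Nonempty ∧
      ∀ e ∈ P, Generates L fun i : Fin N => e i := by
  by_contra! hcon
  let ⟨_⟩ := nonempty_encodable (ℕ ⊕ Σ i : ι, Σ j : ℕ, (Fin (m i) → L.Term (Fin j)))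
  let 𝒟 : ℕ ⊕ (Σ i : ι, Σ j : ℕ, (Fin (m i) → L.Term (Fin j))) → Order.Cofinal (Condition L A) :=
    Sum.elim (fun j => ⟨_, isCofinal_notMem_closure hop hcon j⟩)
      fun q => ⟨_, isCofinal_realizeSome hop (F q.1) (hF q.1) q.2.2⟩
  let a₀ : A := Classical.arbitrary A
  let e₀ : ℕ → A := fun i => if h : i < n then x₀ ⟨i, h⟩ else a₀
  let p₀ : Condition L A := ⟨OrderDual.toDual {e | F₀.RealizeAll A fun i : Fin n => e i},
    ⟨e₀, by simpa [e₀] using hx₀⟩, n, isBasic_realizeAll hF₀ hA hop⟩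
  let p : ℕ → Condition L A := Order.sequenceOfCofinals p₀ 𝒟
  have hmono : ∀ {r s}, r ≤ s → OrderDual.ofDual (p s).1 ⊆ OrderDual.ofDual (p r).1 :=
    fun hrs => Order.sequenceOfCofinals.monotone p₀ 𝒟 hrs
  -- Row `r` is any member of the condition `p r`. Conditions shrink, so whatever is forced at stage
  -- `s` holds in all rows `r ≥ s`, hence in the limit.
  choose e he using fun r => (p r).2.1
  have hmem : ∀ q, p (Encodable.encode q + 1) ∈ 𝒟 q :=
    Order.sequenceOfCofinals.encode_mem p₀ 𝒟
  obtain ⟨B, _, b, hBc, hgen, hreal⟩ := exists_limit_structure (L := L) e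
  have hF₀B : F₀.RealizeAll B fun i : Fin n => b i := by
    intro i y
    choose t ht using fun k => hgen (y k)
    have h1 := hreal (F₀.form i) (F₀.isQF i) (Fin.append (fun i : Fin n => .var i) t)
      ⟨0, fun r _ => by
        have h2 : F₀.RealizeAll A fun i : Fin n => e r i := hmono (Nat.zero_le r) (he r)
        convert h2 i fun k => (t k).realize (e r) using 1
        funext k
        refine Fin.addCases (fun k => ?_) (fun k => ?_) k <;> simp⟩
    convert h1 using 1
    funext k
    refine Fin.addCases (fun k => ?_) (fun k => ?_) k <;> simp [ht]
  have hFB : ∀ i y, (F i).RealizeSome B y := by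
    intro i y
    choose t ht using fun k => hgen (y k)
    obtain ⟨j, t', ht'⟩ := exists_relabel_fin_tuple t
    obtain ⟨k, N, hk⟩ := hmem (.inr ⟨i, j, t'⟩)
    refine ⟨k, fun l => b (N + l), ?_⟩
    have h1 := hreal ((F i).form k) ((F i).isQF k) (Fin.append t fun l => .var (N + l))
      ⟨Encodable.encode (Sum.inr ⟨i, j, t'⟩ :
        ℕ ⊕ Σ i : ι, Σ j : ℕ, (Fin (m i) → L.Term (Fin j))) + 1, fun r hr => by
        convert hk (e r) (hmono hr (he r)) using 1
        funext k
        refine Fin.addCases (fun k => ?_) (fun k => ?_) k <;>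
          simp [ht', Term.realize_relabel, Function.comp_def]⟩
    convert h1 using 1
    funext k
    refine Fin.addCases (fun k => ?_) (fun k => ?_) k <;> simp [ht]
  obtain ⟨k, c, hc⟩ := hB B (fun i => b i) hF₀B hFB
  choose t ht using fun i => hgen (c i)
  obtain ⟨j, t', ht'⟩ := exists_relabel_fin_tuple t
  -- The generators `c` are terms in the first `j` elements of `b`, so these generate `B`; yet some
  -- `b N` with `N ≥ j` was forced outside the closure of its predecessors.
  obtain ⟨N, hN, hNe⟩ := hmem (.inl j)
  have hbN : b N ∈ Substructure.closure L (Set.range fun i : Fin N => b i) := by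
    have h1 : Substructure.closure L (Set.range c) ≤
        Substructure.closure L (Set.range fun i : Fin N => b i) := by
      rw [Substructure.closure_le]
      rintro _ ⟨i, rfl⟩
      rw [SetLike.mem_coe, mem_closure_range_iff]
      refine ⟨(t' i).relabel (Fin.castLE hN), ?_⟩
      rw [← ht i, ht' i, Term.realize_relabel, Term.realize_relabel]
      rfl
    rw [hc] at h1
    exact h1 trivial
  obtain ⟨s, hs⟩ := mem_closure_range_iff.1 hbN
  -- The inequation `b N ≠ s(b)` is quantifier-free, so it passes to the limit.
  have h2 := hreal (k := 2) (∼ ((Term.var 0).equal (Term.var 1)))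
    (BoundedFormula.IsQF.not (BoundedFormula.IsAtomic.equal _ _).isQF)
    ![.var N, s.relabel fun i : Fin N => (i : ℕ)]
    ⟨Encodable.encode (Sum.inl j :
        ℕ ⊕ Σ i : ι, Σ j : ℕ, (Fin (m i) → L.Term (Fin j))) + 1, fun r hr => by
      have h3 := hNe (e r) (hmono hr (he r))
      simp only [Formula.realize_not, Formula.realize_equal, Term.realize_var]
      intro h4
      refine h3 (mem_closure_range_iff.2 ⟨s, ?_⟩)
      simpa [Term.realize_relabel, Function.comp_def, eq_comm] using h4⟩
  simp only [Formula.realize_not, Formula.realize_equal, Term.realize_var] at h2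
  refine h2 ?_
  simp [Term.realize_relabel, ← hs, Function.comp_def]

end Forcing

/-! ### From a Scott sentence to decidable orbits -/

section Orbits

variable {L : FirstOrder.Language.{u, v}}

theorem SatEqs.map {B C : Type} [L.Structure B] [L.Structure C] {n : ℕ}
    {E : List (L.Term (Fin n) × L.Term (Fin n))} {x : Fin n → B} (hx : SatEqs E x) (h : B →[L] C) :
    SatEqs E fun i => h (x i) := by
  intro p hp
  have h1 := congrArg h (hx p hp)
  rw [← HomClass.realize_term h, ← HomClass.realize_term h] at h1
  exact h1

/-- A finitely presented structure has a finite presentation on each finite generating tuple. -/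
theorem IsFinitelyPresentedIn.exists_equations {K : (B : Type) → [L.Structure B] → Prop} {A : Type}
    [L.Structure A] (hfp : IsFinitelyPresentedIn K A) {n : ℕ} {a : Fin n → A}
    (ha : Generates L a) :
    ∃ E : List (L.Term (Fin n) × L.Term (Fin n)), SatEqs E a ∧
      ∀ x : Fin n → A, SatEqs E x → ∃ h : A →[L] A, ∀ i, h (a i) = x i := by
  obtain ⟨hK, m, c, ψ, hc, hψ, hhom⟩ := hfp
  rw [Generates.iff_terms] at ha hc
  choose s hs using fun i => ha (c i)
  choose t ht using fun i => hc (a i)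
  -- With `c = s(a)` and `a = t(c)`, the new relations are `ψ(s(x))` and `x = t(s(x))`, as in a
  -- Tietze transformation.
  refine ⟨ψ.map (fun p => (p.1.subst s, p.2.subst s)) ++
    List.ofFn fun i => (.var i, (t i).subst s), ?_, fun x hx => ?_⟩
  · intro p hp
    rcases List.mem_append.1 hp with hp | hp
    · obtain ⟨q, hq, rfl⟩ := List.mem_map.1 hp
      simpa [Term.realize_subst, hs] using hψ q hq
    · obtain ⟨i, rfl⟩ := (List.mem_ofFn' _ _).1 hp
      simp [Term.realize_subst, hs, ht]
  · have h1 : SatEqs ψ fun i => (s i).realize x := by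
      intro q hq
      simpa [Term.realize_subst] using
        hx _ (List.mem_append_left _ (List.mem_map.2 ⟨q, hq, rfl⟩))
    obtain ⟨h, hh⟩ := hhom A hK _ h1
    refine ⟨h, fun i => ?_⟩
    have h2 := hx _ (List.mem_append_right _ ((List.mem_ofFn' _ _).2 ⟨i, rfl⟩))
    simp only [Term.realize_var, Term.realize_subst] at h2
    rw [h2, ← ht i, ← HomClass.realize_term h]
    congr 1
    funext j
    exact hh j

theorem mem_orbit_iff {A : Type} [L.Structure A] (hhopf : IsHopfian L A) {n : ℕ} {a : Fin n → A}
    (ha : Generates L a) {E : List (L.Term (Fin n) × L.Term (Fin n))} (hE : SatEqs E a)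
    (hhom : ∀ x : Fin n → A, SatEqs E x → ∃ h : A →[L] A, ∀ i, h (a i) = x i) (x : Fin n → A) :
    (∃ g : A ≃[L] A, ∀ i, x i = g (a i)) ↔ SatEqs E x ∧ Generates L x := by
  constructor
  · rintro ⟨g, hg⟩
    rw [funext hg]
    exact ⟨hE.map g.toHom, ha.of_hom_surjective g.toHom g.surjective⟩
  · rintro ⟨h1, h2⟩
    obtain ⟨h, hh⟩ := hhom x h1
    rw [← funext hh] at h2
    obtain ⟨g, hg⟩ := hhopf h (Generates.surjective_of_hom h h2)
    exact ⟨g, fun i => by rw [hg, hh]⟩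

variable [Encodable (Σ l, L.Functions l)] [Finite (Σ l, L.Functions l)]
  {A : Set ℕ} [L.Structure A] {op : ℕ → List ℕ → ℕ}

theorem exists_computable_satEqs (hop : ComputesOps L A op) {n : ℕ}
    (E : List (L.Term (Fin n) × L.Term (Fin n))) :
    ∃ f : List ℕ → Bool, Computable f ∧
      ∀ x : Fin n → A, f (List.ofFn fun i => (x i : ℕ)) = true ↔ SatEqs E x := by
  refine ⟨fun l => decide
    (evalWord L op l ((E.map Prod.fst).flatMap (termWord fun i : Fin n => (i : ℕ))) =
      evalWord L op l ((E.map Prod.snd).flatMap (termWord fun i : Fin n => (i : ℕ)))),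
    ?_, fun x => ?_⟩
  · exact computable_decide_eq
      ((computable_evalWord hop.computable).comp Computable.id (Computable.const _))
      ((computable_evalWord hop.computable).comp Computable.id (Computable.const _))
  · rw [decide_eq_true_iff, evalWord_flatMap hop, evalWord_flatMap hop, List.map_map, List.map_map,
      List.map_inj_left]
    simp only [Function.comp_apply, ← Subtype.ext_iff]
    rfl

/-- Invariance puts `r(x)` outside `Q` when `x` is in the orbit. Conversely, if `r(x)` is outside
`Q` it generates; it is the image of `c` under the endomorphism taking `a` to `x`, which is
therefore onto. -/
theorem decidableWeakWhitehead_of_exists_rePred (hA : ComputablePred fun k => k ∈ A)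
    (hop : ComputesOps L A op) (hhopf : IsHopfian L A)
    {K : (B : Type) → [L.Structure B] → Prop} (hfp : IsFinitelyPresentedIn K A)
    (h : ∃ (N : ℕ) (Q : List ℕ → Prop), REPred Q ∧
      (∃ c : Fin N → A, ¬ Q (List.ofFn fun i => (c i : ℕ))) ∧
      (∀ c : Fin N → A, ¬ Q (List.ofFn fun i => (c i : ℕ)) → Generates L c) ∧
      ∀ (g : A ≃[L] A) (c : Fin N → A), ¬ Q (List.ofFn fun i => (c i : ℕ)) →
        ¬ Q (List.ofFn fun i => (g (c i) : ℕ))) :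
    DecidableWeakWhitehead L A := by
  obtain ⟨N, Q, hQ, ⟨c, hc⟩, hgen, hinv⟩ := h
  intro n a ha
  obtain ⟨E, hE, hhom⟩ := hfp.exists_equations ha
  obtain ⟨f, hf, hfE⟩ := exists_computable_satEqs hop E
  obtain ⟨d, hd, hdA⟩ := ComputablePred.computable_iff.1 hA
  have hdA' : ∀ k, k ∈ A ↔ d k = true := fun k => iff_of_eq (congrFun hdA k)
  choose r hr using fun i => (Generates.iff_terms.1 ha) (c i)
  have horb : ∀ x : Fin n → A, (∃ α : A ≃[L] A, ∀ i, (x i : ℕ) = (α (a i) : ℕ)) ↔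
      SatEqs E x ∧ Generates L x := by
    intro x
    rw [← mem_orbit_iff hhopf ha hE hhom]
    simp only [Subtype.ext_iff]
  have hlist : Computable fun x : Fin n → ℕ => List.ofFn x := computable_ofFn_coe n
  have hall : Computable fun x : Fin n → ℕ => (List.ofFn x).all d :=
    computable_list_all hlist (hd.comp Computable.snd)
  have hallA : ∀ x : Fin n → ℕ, (List.ofFn x).all d = true ↔
      ∃ y : Fin n → A, x = fun i => (y i : ℕ) := by
    intro x
    simp only [List.all_eq_true, List.mem_ofFn', Set.forall_mem_range, ← hdA']
    exact ⟨fun hx => ⟨fun i => ⟨x i, hx i⟩, rfl⟩, by rintro ⟨y, rfl⟩ i; exact (y i).2⟩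
  rw [ComputablePred.computable_iff_re_compl_re']
  constructor
  -- Generation by `x` is c.e. because it suffices to reach the finitely many entries of `a`.
  · have h1 : REPred fun x : Fin n → ℕ => ∀ i, ∃ w,
        (evalWord L op (List.ofFn x) w).head? = some (a i : ℕ) :=
      rePred_forall_fin fun i => REPred.exists (rePred_eq (Primrec.list_head?.to_comp.comp
        ((computable_evalWord hop.computable).comp (hlist.comp Computable.fst) Computable.snd))
        (Computable.const _))
    refine ((rePred_eq_true hall).and ((rePred_eq_true (hf.comp hlist)).and h1)).of_eq
      fun x => ?_
    rw [hallA]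
    constructor
    · rintro ⟨⟨x, rfl⟩, h2, h3⟩
      refine (horb x).2 ⟨(hfE x).1 h2, ?_⟩
      rw [Generates, eq_top_iff, ← ha, Substructure.closure_le]
      rintro _ ⟨i, rfl⟩
      exact (mem_closure_range_iff_evalWord hop).2 (h3 i)
    · intro hx
      obtain ⟨α, hα⟩ := hx
      obtain rfl : x = fun i => (α (a i) : ℕ) := funext hα
      obtain ⟨h2, h3⟩ := (horb fun i => α (a i)).1 ⟨α, fun i => rfl⟩
      refine ⟨⟨_, rfl⟩, (hfE fun i => α (a i)).2 h2, fun i => ?_⟩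
      refine (mem_closure_range_iff_evalWord hop (x := fun i => α (a i))).1 ?_
      rw [h3]
      trivial
  · have h1 : REPred fun x : Fin n → ℕ => Q (evalWord L op (List.ofFn x)
        ((List.ofFn r).flatMap (termWord fun i : Fin n => (i : ℕ)))) :=
      hQ.comp ((computable_evalWord hop.computable).comp hlist (Computable.const _))
    refine ((REPred.ne_true hall).or ((REPred.ne_true (hf.comp hlist)).or h1)).of_eq fun x => ?_
    by_cases hx : ∃ y : Fin n → A, x = fun i => (y i : ℕ)
    · obtain ⟨x, rfl⟩ := hx
      rw [hallA, horb, hfE, evalWord_flatMap hop, List.map_ofFn]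
      have hnot : ¬ ¬ ∃ y : Fin n → A, (fun i => (x i : ℕ)) = fun i => (y i : ℕ) :=
        not_not.2 ⟨x, rfl⟩
      rw [or_iff_right hnot, not_and, ← imp_iff_not_or]
      refine imp_congr_right fun hEx => ⟨fun hq hx => ?_, fun hx => ?_⟩
      · obtain ⟨g, hg⟩ := (mem_orbit_iff hhopf ha hE hhom x).2 ⟨hEx, hx⟩
        refine hinv g c hc ?_
        convert hq using 2
        funext i
        simp only [Function.comp_apply]
        rw [← hr i, funext hg]
        exact congrArg _ (HomClass.realize_term g).symm
      · by_contra hq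
        obtain ⟨h, hh⟩ := hhom x hEx
        have h2 := hgen (fun i => (r i).realize x) hq
        have h3 : (fun i => (r i).realize x) = h ∘ c := by
          funext i
          rw [Function.comp_apply, ← hr i, ← funext hh]
          exact HomClass.realize_term h
        rw [h3] at h2
        refine hx ?_
        rw [← funext hh]
        exact ha.of_hom_surjective h (Generates.surjective_of_hom h h2)
    · have h2 : ¬ (List.ofFn x).all d = true := fun h => hx ((hallA x).1 h)
      refine iff_of_true (.inl h2) ?_
      rintro ⟨α, hα⟩
      exact hx ⟨_, funext hα⟩

variable [L.IsAlgebraic]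

theorem fin_append_elim0 {B : Type} {m : ℕ} (x : Fin (0 + m) → B) :
    Fin.append Fin.elim0 (fun i => x (Fin.natAdd 0 i)) = x := by
  funext i
  refine Fin.addCases (fun i => i.elim0) (fun i => ?_) i
  simp

theorem decidableWeakWhitehead_of_isScottSentence (hcomp : IsComputableStructure L A)
    (hhopf : IsHopfian L A) {K : (B : Type) → [L.Structure B] → Prop}
    (hfp : IsFinitelyPresentedIn K A) {φ : InfFormula L 0} (hφ : IsComputableDSigma 2 φ)
    (hs : IsScottSentence A φ) : DecidableWeakWhitehead L A := by
  obtain ⟨op, hop⟩ := hcomp.exists_computesOps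
  refine decidableWeakWhitehead_of_exists_rePred hcomp.1 hop hhopf hfp ?_
  rcases isEmpty_or_nonempty A with hempty | hne
  -- The forcing needs a nonempty `A`; in an empty structure the empty tuple generates.
  · exact ⟨0, fun _ => False, (rePred_eq_true (Computable.const false)).of_eq fun _ => by simp,
      ⟨Fin.elim0, not_false⟩, fun c _ => eq_top_iff.2 fun z => (hempty.false z).elim,
      fun _ _ h => h⟩
  obtain ⟨σ, π, ⟨e₁, hσ⟩, ⟨e₂, hπ⟩, rfl⟩ := hφ
  obtain ⟨ι₁, m₁, F₁, hF₁, hσF⟩ := hσ.exists_families_sigma_two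
  obtain ⟨ι₂, m₂, F₂, _, hπF⟩ := hπ.exists_families_pi_two
  have hAφ := (hs A).2 ⟨FirstOrder.Language.Equiv.refl L A⟩
  simp only [InfFormula.Realize, hσF, hπF] at hAφ
  obtain ⟨⟨i, y, hy⟩, hπA⟩ := hAφ
  obtain ⟨P, N, ⟨Q, hQ, hPQ, hPg⟩, ⟨e, he⟩, hgen⟩ :=
    exists_isBasic_generates hcomp.1 hop (hF₁ i) hy
      (F := F₂) (fun i y => by
        rw [← fin_append_elim0 y]
        exact hπA i _)
      (by
        intro B _ _ x hx hB
        have hBφ : (InfFormula.conj σ π).Realize B Fin.elim0 := by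
          simp only [InfFormula.Realize, hσF, hπF]
          refine ⟨⟨i, fun j => x (Fin.natAdd 0 j), ?_⟩, fun j y => hB j _⟩
          rw [fin_append_elim0]
          exact hx
        obtain ⟨g⟩ := (hs B).1 hBφ
        obtain ⟨-, n, a, -, ha, -⟩ := hfp
        exact ⟨n, _, ha.of_hom_surjective g.toHom g.surjective⟩)
  have hext : ∀ c : Fin N → A, ∃ e : ℕ → A, c = fun i : Fin N => e i := fun c =>
    ⟨fun i => if h : i < N then c ⟨i, h⟩ else e i, by simp⟩
  refine ⟨N, Q, hQ, ⟨_, (hPQ e).1 he⟩, fun c hc => ?_, fun g c hc => ?_⟩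
  · obtain ⟨e, rfl⟩ := hext c
    exact hgen e ((hPQ e).2 hc)
  · obtain ⟨e, rfl⟩ := hext c
    exact (hPQ _).1 (hPg g e ((hPQ e).2 hc))

end Orbits

/-! ### Systems of equations and their negations as quantifier-free formulas -/

section Equations

variable {L : FirstOrder.Language.{u, v}} {M : ℕ}

/-- The negation of a system of equations. -/
def negEqs : List (L.Term (Fin M) × L.Term (Fin M)) → L.BoundedFormula (Fin M) 0
  | [] => .falsum
  | p :: E => ((p.1.relabel Sum.inl).bdEqual (p.2.relabel Sum.inl)).imp (negEqs E)

/-- A system of equations or its negation. -/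
def eqsFormula (b : Bool) (E : List (L.Term (Fin M) × L.Term (Fin M))) : L.Formula (Fin M) :=
  if b then (negEqs E).imp .falsum else negEqs E

theorem isQF_negEqs (E : List (L.Term (Fin M) × L.Term (Fin M))) : (negEqs E).IsQF := by
  induction E with
  | nil => exact .falsum
  | cons p E ih => exact .imp (BoundedFormula.IsAtomic.equal _ _).isQF ih

theorem isQF_eqsFormula (b : Bool) (E : List (L.Term (Fin M) × L.Term (Fin M))) :
    BoundedFormula.IsQF (eqsFormula b E) := by
  cases b
  · exact isQF_negEqs E
  · exact .imp (isQF_negEqs E) .falsum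

theorem realize_negEqs {B : Type} [L.Structure B] (E : List (L.Term (Fin M) × L.Term (Fin M)))
    (x : Fin M → B) (y : Fin 0 → B) : (negEqs E).Realize x y ↔ ¬ SatEqs E x := by
  induction E with
  | nil => simp [negEqs, SatEqs, BoundedFormula.Realize]
  | cons p E ih =>
    simp only [negEqs, BoundedFormula.realize_imp, BoundedFormula.realize_bdEqual, ih,
      Term.realize_relabel, Sum.elim_comp_inl, SatEqs, List.forall_mem_cons, not_and]

theorem realize_eqsFormula {B : Type} [L.Structure B] (b : Bool)
    (E : List (L.Term (Fin M) × L.Term (Fin M))) (x : Fin M → B) :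
    (eqsFormula b E).Realize x ↔ (b = true ↔ SatEqs E x) := by
  cases b
  · simp [eqsFormula, Formula.Realize, realize_negEqs]
  · simp only [eqsFormula, Formula.Realize, if_true, BoundedFormula.realize_imp, realize_negEqs,
      true_iff]
    exact not_not

/-- The code of `eqsFormula`, computed from the words of the terms. -/
def eqsCode (b : Bool) (E : List (List ℕ × List ℕ)) : ℕ :=
  Encodable.encode
    ((bif b then [3] else []) ++ (E.flatMap fun p => [3, termItem p.1, termItem p.2]) ++ [11] ++
      (bif b then [11] else []))

theorem computable_eqsCode : Computable₂ eqsCode := by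
  have hitem : Primrec termItem :=
    Primrec.nat_mul.comp (Primrec.const 2)
      (Primrec₂.natPair.comp (Primrec.const 0) Primrec.encode)
  have h1 : Primrec fun q : Bool × List (List ℕ × List ℕ) =>
      q.2.flatMap fun p => [3, termItem p.1, termItem p.2] := by
    refine Primrec.list_flatMap Primrec.snd ?_
    refine Primrec.list_cons.comp (Primrec.const 3) (Primrec.list_cons.comp ?_
      (Primrec.list_cons.comp ?_ (Primrec.const [])))
    · exact hitem.comp (Primrec.fst.comp Primrec.snd)
    · exact hitem.comp (Primrec.snd.comp Primrec.snd)
  refine Primrec.to_comp (Primrec.encode.comp (Primrec.list_append.comp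
    (Primrec.list_append.comp (Primrec.list_append.comp
      (Primrec.cond Primrec.fst (Primrec.const [3]) (Primrec.const [])) h1) (Primrec.const [11]))
    (Primrec.cond Primrec.fst (Primrec.const [11]) (Primrec.const []))))

variable [Encodable (Σ l, L.Functions l)] [L.IsAlgebraic]

/-- The words of the two sides of an equation. -/
noncomputable def eqWords (p : L.Term (Fin M) × L.Term (Fin M)) : List ℕ × List ℕ :=
  (termWord (fun i : Fin M => 2 * (i : ℕ)) p.1, termWord (fun i : Fin M => 2 * (i : ℕ)) p.2)

/-- The symbols depend on the terms only through their words, so Gödel numbers can be computed from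
words. The numbering `2 * i` in `eqWords` is the code of `Sum.inl i`. -/
theorem formulaItems_negEqs (E : List (L.Term (Fin M) × L.Term (Fin M))) :
    formulaItems (negEqs E) =
      ((E.map eqWords).flatMap fun p => [3, termItem p.1, termItem p.2]) ++ [11] := by
  induction E with
  | nil => exact formulaItems_falsum
  | cons p E ih =>
    have h : ∀ t : L.Term (Fin M),
        termWord Encodable.encode (t.relabel (Sum.inl : Fin M → Fin M ⊕ Fin 0)) =
          termWord (fun i : Fin M => 2 * (i : ℕ)) t := fun t => by
      rw [termWord_relabel]
      simp [encode_fin]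
    rw [negEqs, formulaItems_imp, Term.bdEqual, formulaItems_equal, ih, h, h]
    simp [eqWords]

theorem formulaCode_eqsFormula (b : Bool) (E : List (L.Term (Fin M) × L.Term (Fin M))) :
    formulaCode (eqsFormula b E) = eqsCode b (E.map eqWords) := by
  rw [formulaCode_eq, eqsCode]
  cases b
  · have : formulaItems (eqsFormula false E) = formulaItems (negEqs E) := rfl
    rw [this, formulaItems_negEqs]
    simp
  · have : formulaItems (eqsFormula true E) = formulaItems ((negEqs E).imp .falsum) := rfl
    rw [this, formulaItems_imp, formulaItems_negEqs, formulaItems_falsum]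
    simp

end Equations

/-! ### From decidable orbits to a Scott sentence -/

section ScottSentence

theorem InfFormula.realize_equiv {L : FirstOrder.Language.{u, v}} {B C : Type} [L.Structure B]
    [L.Structure C] (g : B ≃[L] C) {n : ℕ} (φ : InfFormula L n) (x : Fin n → B) :
    φ.Realize C (g ∘ x) ↔ φ.Realize B x := by
  have happ : ∀ {n m : ℕ} (x : Fin n → B) (y : Fin m → B),
      Fin.append (g ∘ x) (g ∘ y) = g ∘ Fin.append x y := by
    intro n m x y
    funext i
    refine Fin.addCases (fun i => ?_) (fun i => ?_) i <;> simp
  have hsurj : ∀ {m : ℕ} (y : Fin m → C), ∃ y' : Fin m → B, y = g ∘ y' := fun y =>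
    ⟨fun i => g.symm (y i), funext fun i => (g.apply_symm_apply _).symm⟩
  induction φ with
  | finitary φ => exact StrongHomClass.realize_formula g φ
  | ex m ψ ih =>
    constructor
    · rintro ⟨y, hy⟩
      obtain ⟨y, rfl⟩ := hsurj y
      rw [happ] at hy
      exact ⟨y, (ih _).1 hy⟩
    · rintro ⟨y, hy⟩
      refine ⟨g ∘ y, ?_⟩
      rw [happ]
      exact (ih _).2 hy
  | all m ψ ih =>
    constructor
    · intro h y
      have := h (g ∘ y)
      rw [happ] at this
      exact (ih _).1 this
    · intro h y
      obtain ⟨y, rfl⟩ := hsurj y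
      rw [happ]
      exact (ih _).2 (h y)
  | bigOr S ψ ih => exact exists_congr fun k => ih k x
  | bigAnd S ψ ih => exact forall_congr' fun k => ih k x
  | conj φ ψ ih1 ih2 => exact and_congr (ih1 x) (ih2 x)

variable {L : FirstOrder.Language.{u, v}}

/-- Structures generated by tuples with the same equations are isomorphic. -/
theorem exists_equiv_of_same_equations [L.IsAlgebraic] {B C : Type} [L.Structure B]
    [L.Structure C] {n : ℕ} {b : Fin n → B} {c : Fin n → C} (hb : Generates L b)
    (hc : Generates L c)
    (h : ∀ t s : L.Term (Fin n), t.realize b = s.realize b ↔ t.realize c = s.realize c) :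
    Nonempty (B ≃[L] C) := by
  rw [Generates.iff_terms] at hb hc
  choose t ht using hb
  have hf : ∀ s : L.Term (Fin n), (t (s.realize b)).realize c = s.realize c := fun s =>
    (h _ _).1 (ht _)
  refine ⟨{ toEquiv := Equiv.ofBijective (fun z => (t z).realize c) ⟨fun z z' hz => ?_, fun z => ?_⟩,
            map_fun' := fun f y => ?_, map_rel' := fun r => isEmptyElim r }⟩
  · rw [← ht z, ← ht z']
    exact (h _ _).2 hz
  · obtain ⟨s, rfl⟩ := hc z
    exact ⟨s.realize b, hf s⟩
  · have h1 : Structure.funMap f y = (Term.func f fun i => t (y i)).realize b := by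
      simp [Term.realize, ht]
    change (t (Structure.funMap f y)).realize c = _
    rw [h1, hf]
    rfl

/-- The conjunction of all equations and inequations that hold at `a`, and of the formulas saying
that no system of equations `ψ(y) ∧ x = t(y)` with `t ∈ T` is solvable. -/
def OrbitFormula {A : Type} [L.Structure A] {n : ℕ} (a : Fin n → A)
    (ψ : List (L.Term (Fin n) × L.Term (Fin n))) (T : Set (Fin n → L.Term (Fin n))) (B : Type)
    [L.Structure B] (x : Fin n → B) : Prop :=
  (∀ t s : L.Term (Fin n), t.realize a = s.realize a ↔ t.realize x = s.realize x) ∧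
    ∀ t ∈ T, ∀ y : Fin n → B, ¬ (SatEqs ψ y ∧ ∀ i, x i = (t i).realize y)

/-- If `a = t(y)` with `ψ(y)`, the endomorphism taking `a` to `y` takes `t(a)` to `a`, so it is
onto, hence an automorphism whose inverse puts `t(a)` in the orbit. In the other direction, `x =
t(a)` for some `t`, and the solution `y = a` excludes `t ∈ T`. -/
theorem orbitFormula_iff {A : Type} [L.Structure A] (hhopf : IsHopfian L A) {n : ℕ} {a : Fin n → A}
    (ha : Generates L a) {ψ : List (L.Term (Fin n) × L.Term (Fin n))} (hψ : SatEqs ψ a)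
    (hhom : ∀ x : Fin n → A, SatEqs ψ x → ∃ h : A →[L] A, ∀ i, h (a i) = x i)
    {T : Set (Fin n → L.Term (Fin n))}
    (hT : ∀ t, t ∈ T ↔ ¬ ∃ g : A ≃[L] A, ∀ i, (t i).realize a = g (a i)) :
    OrbitFormula a ψ T A a ∧ ∀ x, OrbitFormula a ψ T A x → Generates L x := by
  refine ⟨⟨fun _ _ => Iff.rfl, fun t ht y ⟨hy, hay⟩ => ?_⟩, fun x hx => ?_⟩
  · obtain ⟨h, hh⟩ := hhom y hy
    have h1 : ∀ i, h ((t i).realize a) = a i := fun i => by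
      rw [hay i, ← funext hh]
      exact (HomClass.realize_term h).symm
    have h2 : Generates L (h ∘ fun i => (t i).realize a) := by
      rw [show (h ∘ fun i => (t i).realize a) = a from funext h1]
      exact ha
    obtain ⟨g, hg⟩ := hhopf h (Generates.surjective_of_hom h h2)
    refine (hT t).1 ht ⟨g.symm, fun i => g.injective ?_⟩
    rw [hg, h1, g.apply_symm_apply]
  · choose t ht using fun i => Generates.iff_terms.1 ha (x i)
    have h1 : t ∉ T := fun h => hx.2 t h a ⟨hψ, fun i => (ht i).symm⟩
    rw [hT, not_not] at h1
    obtain ⟨g, hg⟩ := h1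
    have h2 : x = g.toHom ∘ a := funext fun i => by
      rw [← ht i, hg i]
      rfl
    rw [h2]
    exact ha.of_hom_surjective g.toHom g.surjective

theorem satEqs_append {B : Type} [L.Structure B] {n : ℕ}
    {E E' : List (L.Term (Fin n) × L.Term (Fin n))} {x : Fin n → B} :
    SatEqs (E ++ E') x ↔ SatEqs E x ∧ SatEqs E' x := by
  simp only [SatEqs, List.forall_mem_append]

/-- The equations `ψ(y) ∧ x = t(y)`, where `x` stands for the first `n` of `N` variables, followed
by the variables `y`. -/
def orbitEqs {n N : ℕ} (hN : n ≤ N) (ψ : List (L.Term (Fin n) × L.Term (Fin n)))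
    (t : Fin n → L.Term (Fin n)) : List (L.Term (Fin (N + n)) × L.Term (Fin (N + n))) :=
  ψ.map (fun p => (p.1.relabel (Fin.natAdd N), p.2.relabel (Fin.natAdd N))) ++
    List.ofFn fun i => (.var (Fin.castAdd n (Fin.castLE hN i)), (t i).relabel (Fin.natAdd N))

theorem satEqs_orbitEqs {n N : ℕ} (hN : n ≤ N) (ψ : List (L.Term (Fin n) × L.Term (Fin n)))
    (t : Fin n → L.Term (Fin n)) {B : Type} [L.Structure B] (x : Fin N → B) (y : Fin n → B) :
    SatEqs (orbitEqs hN ψ t) (Fin.append x y) ↔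
      SatEqs ψ y ∧ ∀ i, x (Fin.castLE hN i) = (t i).realize y := by
  have happ : Fin.append x y ∘ Fin.natAdd N = y := funext fun i => by simp
  rw [orbitEqs, satEqs_append]
  refine and_congr ?_ ?_
  · simp only [SatEqs, List.forall_mem_map, Term.realize_relabel, happ]
  · simp only [SatEqs, List.mem_ofFn', Set.forall_mem_range, Term.realize_relabel, happ,
      Term.realize_var, Fin.append_left]

/-- The family of quantifier-free formulas for `OrbitFormula` on the first `n` of `N` variables
(`sgn = true`), or for its negation (`sgn = false`). -/
noncomputable def orbitFamily {A : Type} [L.Structure A] {n : ℕ} (a : Fin n → A)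
    (ψ : List (L.Term (Fin n) × L.Term (Fin n))) (T : Set (Fin n → L.Term (Fin n))) {N : ℕ}
    (hN : n ≤ N) (sgn : Bool) : QFFamily.{u, v, u} L N where
  ι := (L.Term (Fin n) × L.Term (Fin n)) ⊕ T
  len := Sum.elim (fun _ => 0) fun _ => n
  form
    | .inl p => open Classical in eqsFormula (sgn == decide (p.1.realize a = p.2.realize a))
        [(p.1.relabel (Fin.castLE hN), p.2.relabel (Fin.castLE hN))]
    | .inr t => eqsFormula (!sgn) (orbitEqs hN ψ t.1)
  isQF i := by
    rcases i with p | t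
    · exact isQF_eqsFormula _ _
    · exact isQF_eqsFormula _ _

open Classical in
theorem realizeAll_orbitFamily {A : Type} [L.Structure A] {n : ℕ} (a : Fin n → A)
    (ψ : List (L.Term (Fin n) × L.Term (Fin n))) (T : Set (Fin n → L.Term (Fin n))) {N : ℕ}
    (hN : n ≤ N) (B : Type) [L.Structure B] (x : Fin N → B) :
    (orbitFamily a ψ T hN true).RealizeAll B x ↔
      OrbitFormula a ψ T B fun i => x (Fin.castLE hN i) := by
  rw [QFFamily.RealizeAll, OrbitFormula]
  refine Sum.forall.trans (and_congr ?_ ?_)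
  · refine Prod.forall.trans (forall₂_congr fun t s => ?_)
    have h1 : ∀ y : Fin 0 → B, (eqsFormula (true == decide (t.realize a = s.realize a))
        [(t.relabel (Fin.castLE hN), s.relabel (Fin.castLE hN))]).Realize (Fin.append x y) ↔
        (t.realize a = s.realize a ↔ t.realize (fun i => x (Fin.castLE hN i)) =
          s.realize fun i => x (Fin.castLE hN i)) := by
      intro y
      rw [fin_append_zero, realize_eqsFormula]
      simp [SatEqs, Term.realize_relabel, Function.comp_def]
    exact ⟨fun h => (h1 Fin.elim0).1 (h Fin.elim0), fun h y => (h1 y).2 h⟩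
  · have h1 : ∀ (t : Fin n → L.Term (Fin n)) (y : Fin n → B),
        (eqsFormula (!true) (orbitEqs hN ψ t)).Realize (Fin.append x y) ↔
          ¬ (SatEqs ψ y ∧ ∀ i, x (Fin.castLE hN i) = (t i).realize y) := by
      intro t y
      rw [realize_eqsFormula, satEqs_orbitEqs]
      simp
    exact Subtype.forall.trans (forall₂_congr fun t _ => forall_congr' fun y => h1 t y)

/-- Changing `sgn` negates every member separately, which turns the universal conjunction into the
existential disjunction of the negations. -/
theorem realizeSome_orbitFamily {A : Type} [L.Structure A] {n : ℕ} (a : Fin n → A)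
    (ψ : List (L.Term (Fin n) × L.Term (Fin n))) (T : Set (Fin n → L.Term (Fin n))) {N : ℕ}
    (hN : n ≤ N) (B : Type) [L.Structure B] (x : Fin N → B) :
    (orbitFamily a ψ T hN false).RealizeSome B x ↔
      ¬ OrbitFormula a ψ T B fun i => x (Fin.castLE hN i) := by
  rw [← realizeAll_orbitFamily, QFFamily.RealizeAll, QFFamily.RealizeSome]
  simp only [not_forall]
  refine exists_congr fun i => exists_congr fun y => ?_
  rcases i with p | t
  · refine (realize_eqsFormula (L := L) (B := B) _ _ _).trans ?_
    refine Iff.trans ?_ (not_congr (realize_eqsFormula (L := L) (B := B) _ _ _)).symm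
    simp only [Bool.false_beq, Bool.true_beq, Bool.not_eq_true', decide_eq_false_iff_not,
      decide_eq_true_iff]
    exact not_iff.symm
  · refine (realize_eqsFormula (!false) (orbitEqs hN ψ t.1)
      (Fin.append x (y : Fin n → B))).trans ?_
    refine Iff.trans ?_ (not_congr (realize_eqsFormula (!true) (orbitEqs hN ψ t.1)
      (Fin.append x (y : Fin n → B)))).symm
    simp

end ScottSentence

/-! ### Families expressing generation, and codes of the orbit equations. -/

section Families

variable {L : FirstOrder.Language.{u, v}}

/-- The formulas `z = t(x)`, where `x` stands for the first `n` of `N` variables. -/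
def termFamily (L : FirstOrder.Language.{u, v}) {n N : ℕ} (hN : n ≤ N) (z : Fin N) :
    QFFamily.{u, v, u} L N where
  ι := L.Term (Fin n)
  len _ := 0
  form t := eqsFormula true [(.var z, t.relabel (Fin.castLE hN))]
  isQF _ := isQF_eqsFormula _ _

theorem realizeSome_termFamily {n N : ℕ} (hN : n ≤ N) (z : Fin N) (B : Type) [L.Structure B]
    (x : Fin N → B) : (termFamily L hN z).RealizeSome B x ↔
      ∃ t : L.Term (Fin n), t.realize (fun i => x (Fin.castLE hN i)) = x z := by
  have h1 : ∀ (t : L.Term (Fin n)) (y : Fin 0 → B),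
      (eqsFormula true [(.var z, t.relabel (Fin.castLE hN))]).Realize (Fin.append x y) ↔
        t.realize (fun i => x (Fin.castLE hN i)) = x z := by
    intro t y
    rw [fin_append_zero, realize_eqsFormula]
    simp [SatEqs, Term.realize_relabel, Function.comp_def, eq_comm]
  exact exists_congr fun t =>
    ⟨fun ⟨y, hy⟩ => (h1 t y).1 hy, fun h => ⟨Fin.elim0, (h1 t _).2 h⟩⟩

/-- The union of two families. -/
def QFFamily.sum {n : ℕ} (F G : QFFamily.{u, v, w} L n) : QFFamily.{u, v, w} L n where
  ι := F.ι ⊕ G.ι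
  len := Sum.elim F.len G.len
  form
    | .inl i => F.form i
    | .inr i => G.form i
  isQF i := by
    rcases i with i | i
    · exact F.isQF i
    · exact G.isQF i

theorem QFFamily.realizeSome_sum {n : ℕ} (F G : QFFamily.{u, v, w} L n) (B : Type) [L.Structure B]
    (x : Fin n → B) : (F.sum G).RealizeSome B x ↔ F.RealizeSome B x ∨ G.RealizeSome B x :=
  Sum.exists

variable [Encodable (Σ l, L.Functions l)]

theorem map_eqWords_orbitEqs {n N : ℕ} (hN : n ≤ N)
    (ψ : List (L.Term (Fin n) × L.Term (Fin n))) (t : Fin n → L.Term (Fin n)) :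
    (orbitEqs hN ψ t).map eqWords =
      (ψ.map fun p => eqWords (p.1.relabel (Fin.natAdd N), p.2.relabel (Fin.natAdd N))) ++
        (List.range n).map fun i => ([2 * (2 * i)],
          ((List.ofFn t).map (termWord fun i : Fin n => 2 * (N + (i : ℕ)))).getI i) := by
  rw [orbitEqs, List.map_append, List.map_map]
  congr 1
  apply List.ext_getElem
  · simp
  · intro i h1 h2
    simp only [List.length_map, List.length_range] at h2
    simp [eqWords, termWord, termWord_relabel, List.getI_eq_getElem, h2]

theorem formulaCode_relabel_castLE [L.IsAlgebraic] {n N : ℕ} (hN : n ≤ N) (b : Bool)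
    (p : L.Term (Fin n) × L.Term (Fin n)) :
    formulaCode (eqsFormula b [(p.1.relabel (Fin.castLE hN), p.2.relabel (Fin.castLE hN))]) =
      eqsCode b [(termWord (fun i : Fin n => 2 * (i : ℕ)) p.1,
        termWord (fun i : Fin n => 2 * (i : ℕ)) p.2)] := by
  rw [formulaCode_eqsFormula]
  simp [eqWords, termWord_relabel]

theorem QFFamily.IsRE.sum [L.IsAlgebraic] {n : ℕ} {F G : QFFamily.{u, v, w} L n} (hF : F.IsRE) (hG : G.IsRE) :
    (F.sum G).IsRE :=
  (REPred.or hF hG).of_eq fun k => (Sum.exists (p := fun i : F.ι ⊕ G.ι =>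
    k = Nat.pair ((F.sum G).len i) (formulaCode ((F.sum G).form i)))).symm

end Families

/-! ### Enumeration of the families -/

section Enumeration

variable {L : FirstOrder.Language.{u, v}} [Encodable (Σ l, L.Functions l)]
  [Finite (Σ l, L.Functions l)] {A : Set ℕ} [L.Structure A] {op : ℕ → List ℕ → ℕ}

/-- The search over terms is a search over words: each word is run once in `A` for the values and
once in the algebra of words for the spelling, and both runs refer to the same terms. -/
theorem rePred_exists_terms {α : Type*} [Primcodable α] (hop : ComputesOps L A op) {n : ℕ}
    (a : Fin n → A) (ρ : Fin n → ℕ) {p : α → List ℕ → List (List ℕ) → Prop}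
    (hp : REPred fun q : α × List ℕ × List (List ℕ) => p q.1 q.2.1 q.2.2) :
    REPred fun k => ∃ ts : List (L.Term (Fin n)),
      p k (ts.map fun t => ((t.realize a : A) : ℕ)) (ts.map (termWord ρ)) := by
  have h1 : REPred fun k => ∃ w, p k (evalWord L op (List.ofFn fun i => (a i : ℕ)) w)
      (stackRun (arity L) (fun c args => (2 * c + 1) :: args.flatten)
        (fun c => (Encodable.decode₂ (Fin n) c).map fun i => [2 * ρ i]) w) := by
    refine REPred.exists (hp.comp (Computable.fst.pair (Computable.pair ?_ ?_)))
    · exact (computable_evalWord hop.computable).comp (Computable.const _) Computable.snd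
    · refine computable_stackRun
        (vr := fun _ c => (Encodable.decode₂ (Fin n) c).map fun i => [2 * ρ i])
        computable_arity ?_ ?_ Computable.snd
      · exact (Primrec.list_cons.comp (Primrec.succ.comp (Primrec.nat_mul.comp (Primrec.const 2)
          Primrec.fst)) (Primrec.list_flatten.comp Primrec.snd)).to_comp
      · exact (computable_decode₂_map _).comp Computable.snd
  refine h1.of_eq fun k => ⟨fun ⟨w, hw⟩ => ?_, fun ⟨ts, hts⟩ => ?_⟩
  · obtain ⟨ts, hts⟩ := exists_terms_stackRun (L := L) (α := Fin n) w
    rw [evalWord, hts (hop.isValuation_ofFn a), hts (isValuation_termWord ρ)] at hw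
    exact ⟨ts, hw⟩
  · refine ⟨ts.flatMap (termWord Encodable.encode), ?_⟩
    rw [evalWord, stackRun_flatMap (hop.isValuation_ofFn a),
      stackRun_flatMap (isValuation_termWord ρ)]
    exact hts

variable [L.IsAlgebraic]

/-- Whether `t ∈ T`, and which sign an equation receives, depend only on the values of the terms at
`a`. These are computed along with the words that determine the Gödel number. -/
theorem isRE_orbitFamily (hop : ComputesOps L A op) {n : ℕ} (a : Fin n → A)
    (ψ : List (L.Term (Fin n) × L.Term (Fin n))) {T : Set (Fin n → L.Term (Fin n))}
    {R : (Fin n → ℕ) → Prop} (hR : REPred R)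
    (hT : ∀ t, t ∈ T ↔ R fun i => (((t i).realize a : A) : ℕ)) {N : ℕ} (hN : n ≤ N) (sgn : Bool) :
    (orbitFamily a ψ T hN sgn).IsRE := by
  have h0 : ∀ i, Computable fun q : ℕ × List ℕ × List (List ℕ) => q.2.1.getI i := fun i =>
    Primrec.to_comp (Primrec.list_getI.comp (Primrec.fst.comp Primrec.snd) (Primrec.const i))
  have h0' : ∀ i, Computable fun q : ℕ × List ℕ × List (List ℕ) => q.2.2.getI i := fun i =>
    Primrec.to_comp (Primrec.list_getI.comp (Primrec.snd.comp Primrec.snd) (Primrec.const i))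
  have hlen : Computable fun q : ℕ × List ℕ × List (List ℕ) => q.2.1.length :=
    Computable.list_length.comp (Computable.fst.comp Computable.snd)
  have h1 : REPred fun k : ℕ => ∃ ts : List (L.Term (Fin n)),
      (ts.map fun t => ((t.realize a : A) : ℕ)).length = 2 ∧
      k = Nat.pair 0 (eqsCode
        (sgn == decide ((ts.map fun t => ((t.realize a : A) : ℕ)).getI 0 =
          (ts.map fun t => ((t.realize a : A) : ℕ)).getI 1))
        [((ts.map (termWord fun i : Fin n => 2 * (i : ℕ))).getI 0,
          (ts.map (termWord fun i : Fin n => 2 * (i : ℕ))).getI 1)]) := by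
    refine rePred_exists_terms hop a (fun i => 2 * (i : ℕ)) (p := fun k us ws => us.length = 2 ∧
      k = Nat.pair 0 (eqsCode (sgn == decide (us.getI 0 = us.getI 1))
        [(ws.getI 0, ws.getI 1)])) ((rePred_eq hlen (Computable.const 2)).and
          (rePred_eq Computable.fst (Primrec₂.natPair.to_comp.comp (Computable.const 0)
            (computable_eqsCode.comp ?_ ?_))))
    · exact (Primrec.dom_finite fun b => sgn == b).to_comp.comp
        (computable_decide_eq (h0 0) (h0 1))
    · exact Computable.list_cons.comp ((h0' 0).pair (h0' 1)) (Computable.const [])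
  have h2 : REPred fun k : ℕ => ∃ ts : List (L.Term (Fin n)),
      (ts.map fun t => ((t.realize a : A) : ℕ)).length = n ∧
      R (fun i => (ts.map fun t => ((t.realize a : A) : ℕ)).getI i) ∧
      k = Nat.pair n (eqsCode (!sgn)
        ((ψ.map fun p => eqWords (p.1.relabel (Fin.natAdd N), p.2.relabel (Fin.natAdd N))) ++
        (List.range n).map fun i => ([2 * (2 * i)],
          (ts.map (termWord fun i : Fin n => 2 * (N + (i : ℕ)))).getI i))) := by
    refine rePred_exists_terms hop a (fun i => 2 * (N + (i : ℕ))) (p := fun k us ws =>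
      us.length = n ∧ R (fun i => us.getI i) ∧ k = Nat.pair n (eqsCode (!sgn)
        ((ψ.map fun p => eqWords (p.1.relabel (Fin.natAdd N), p.2.relabel (Fin.natAdd N))) ++
        (List.range n).map fun i => ([2 * (2 * i)], ws.getI i))))
      ((rePred_eq hlen (Computable.const n)).and (REPred.and ?_
          (rePred_eq Computable.fst (Primrec₂.natPair.to_comp.comp (Computable.const n)
            (computable_eqsCode.comp (Computable.const _)
              (Computable.list_append.comp (Computable.const _) ?_))))))
    · exact hR.comp ((computable_getI n).comp (Computable.fst.comp Computable.snd))
    · refine computable_list_map (Computable.const _) (Computable.pair ?_ ?_)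
      · exact (Primrec.list_cons.comp (Primrec.nat_mul.comp (Primrec.const 2)
          (Primrec.nat_mul.comp (Primrec.const 2) Primrec.snd)) (Primrec.const [])).to_comp
      · exact Primrec.to_comp (Primrec.list_getI.comp
          (Primrec.snd.comp (Primrec.snd.comp Primrec.fst)) Primrec.snd)
  refine (h1.or h2).of_eq fun k => Iff.trans (or_congr ?_ ?_) Sum.exists.symm
  · have hcode : ∀ p : L.Term (Fin n) × L.Term (Fin n),
        formulaCode ((orbitFamily a ψ T hN sgn).form (.inl p)) = eqsCode
          (sgn == decide (((p.1.realize a : A) : ℕ) = ((p.2.realize a : A) : ℕ)))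
          [(termWord (fun i : Fin n => 2 * (i : ℕ)) p.1,
            termWord (fun i : Fin n => 2 * (i : ℕ)) p.2)] := by
      intro p
      have h3 : decide (((p.1.realize a : A) : ℕ) = ((p.2.realize a : A) : ℕ)) =
          @decide (p.1.realize a = p.2.realize a) (Classical.propDecidable _) :=
        decide_eq_decide.2 Subtype.ext_iff.symm
      rw [h3]
      exact formulaCode_relabel_castLE hN _ p
    constructor
    · rintro ⟨ts, h3, rfl⟩
      obtain ⟨t, s, rfl⟩ := List.length_eq_two.1 ((List.length_map _).symm.trans h3)
      exact ⟨(t, s), congrArg (Nat.pair 0) (hcode (t, s)).symm⟩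
    · rintro ⟨p, rfl⟩
      exact ⟨[p.1, p.2], rfl, congrArg (Nat.pair 0) (hcode p)⟩
  · have hcode : ∀ t : Fin n → L.Term (Fin n),
        formulaCode (eqsFormula (!sgn) (orbitEqs hN ψ t)) = eqsCode (!sgn)
        ((ψ.map fun p => eqWords (p.1.relabel (Fin.natAdd N), p.2.relabel (Fin.natAdd N))) ++
        (List.range n).map fun i => ([2 * (2 * i)],
          ((List.ofFn t).map (termWord fun i : Fin n => 2 * (N + (i : ℕ)))).getI i)) := by
      intro t
      rw [formulaCode_eqsFormula, map_eqWords_orbitEqs]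
    have hval : ∀ t : Fin n → L.Term (Fin n), (fun i : Fin n =>
        ((List.ofFn t).map fun t => ((t.realize a : A) : ℕ)).getI i) =
          fun i => (((t i).realize a : A) : ℕ) := by
      intro t
      funext i
      rw [List.getI_eq_getElem _ (by simp)]
      simp
    constructor
    · rintro ⟨ts, h3, h4, rfl⟩
      obtain ⟨t, rfl⟩ : ∃ t : Fin n → L.Term (Fin n), ts = List.ofFn t := by
        rw [List.length_map] at h3
        exact ⟨fun i => ts[i], List.ext_getElem (by simp [h3]) fun i _ _ => by simp⟩
      rw [hval] at h4
      exact ⟨⟨t, (hT t).2 h4⟩, congrArg (Nat.pair n) (hcode t).symm⟩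
    · rintro ⟨t, rfl⟩
      refine ⟨List.ofFn t.1, by simp, ?_, congrArg (Nat.pair n) (hcode t.1)⟩
      rw [hval]
      exact (hT _).1 t.2

theorem isRE_termFamily (hop : ComputesOps L A op) {n : ℕ} (a : Fin n → A) {N : ℕ} (hN : n ≤ N)
    (z : Fin N) : (termFamily L hN z).IsRE := by
  have h1 : REPred fun k : ℕ => ∃ ts : List (L.Term (Fin n)),
      (ts.map fun t => ((t.realize a : A) : ℕ)).length = 1 ∧
      k = Nat.pair 0 (eqsCode true
        [([2 * (2 * z)], (ts.map (termWord fun i : Fin n => 2 * (i : ℕ))).getI 0)]) := by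
    refine rePred_exists_terms hop a (fun i => 2 * (i : ℕ)) (p := fun k us ws => us.length = 1 ∧
      k = Nat.pair 0 (eqsCode true [([2 * (2 * (z : ℕ))], ws.getI 0)]))
      ((rePred_eq ?_ (Computable.const 1)).and
          (rePred_eq Computable.fst (Primrec₂.natPair.to_comp.comp (Computable.const 0)
            (computable_eqsCode.comp (Computable.const true)
              (Computable.list_cons.comp (Computable.pair (Computable.const _) ?_)
                (Computable.const []))))))
    · exact Computable.list_length.comp (Computable.fst.comp Computable.snd)
    · exact Primrec.to_comp
        (Primrec.list_getI.comp (Primrec.snd.comp Primrec.snd) (Primrec.const 0))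
  refine h1.of_eq fun k => ?_
  have hcode : ∀ t : L.Term (Fin n),
      formulaCode (eqsFormula true [(.var z, t.relabel (Fin.castLE hN))]) = eqsCode true
        [([2 * (2 * z)], termWord (fun i : Fin n => 2 * (i : ℕ)) t)] := by
    intro t
    rw [formulaCode_eqsFormula]
    simp [eqWords, termWord_relabel, termWord]
  constructor
  · rintro ⟨ts, h3, rfl⟩
    obtain ⟨t, rfl⟩ := List.length_eq_one_iff.1 ((List.length_map _).symm.trans h3)
    exact ⟨t, congrArg (Nat.pair 0) (hcode t).symm⟩
  · rintro ⟨t, rfl⟩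
    let t' : L.Term (Fin n) := t
    exact ⟨[t'], rfl, congrArg (Nat.pair 0) (hcode t')⟩

theorem exists_isScottSentence_of_decidableWeakWhitehead (hcomp : IsComputableStructure L A)
    (hhopf : IsHopfian L A) {K : (B : Type) → [L.Structure B] → Prop}
    (hfp : IsFinitelyPresentedIn K A) (hdec : DecidableWeakWhitehead L A) :
    ∃ φ : InfFormula L 0, IsComputableDSigma 2 φ ∧ IsScottSentence A φ := by
  obtain ⟨op, hop⟩ := hcomp.exists_computesOps
  obtain ⟨hK, n, a, ψ, ha, hψ, hhom⟩ := hfp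
  let T : Set (Fin n → L.Term (Fin n)) :=
    {t | ¬ ∃ g : A ≃[L] A, ∀ i, (t i).realize a = g (a i)}
  obtain ⟨hTa, hTg⟩ := orbitFormula_iff hhopf ha hψ (hhom A hK) (T := T) fun _ => Iff.rfl
  have hT : ∀ t, t ∈ T ↔ ¬ ∃ g : A ≃[L] A, ∀ i, (((t i).realize a : A) : ℕ) = (g (a i) : ℕ) := by
    intro t
    simp only [← Subtype.ext_iff]
    rfl
  -- Only the enumerability of the complement of the orbit is used.
  have hR := (hdec n a ha).not.to_re
  have hN : n ≤ 0 + n := by omega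
  have hN' : n ≤ 0 + (n + 1) := by omega
  -- The last of the `n + 1` universally quantified variables is the element that must be a term in
  -- the first `n`. Quantifying it outside keeps the matrix `Σ₁`.
  let z : Fin (0 + (n + 1)) := Fin.natAdd 0 (Fin.last n)
  obtain ⟨e₁, φ₁, h1, h1'⟩ := (isRE_orbitFamily hop a ψ hR hT hN true).exists_hasIndex_pi
  obtain ⟨e₂, φ₂, h2, h2'⟩ := ((isRE_orbitFamily hop a ψ hR hT hN' false).sum
    (isRE_termFamily hop a hN' z)).exists_hasIndex_sigma
  obtain ⟨σ, hσ, hσ'⟩ := h1.exists_isComputableSigma_ex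
  obtain ⟨π, hπ, hπ'⟩ := h2.exists_isComputablePi_all
  have hσB : ∀ (B : Type) [L.Structure B], σ.Realize B Fin.elim0 ↔
      ∃ x : Fin n → B, OrbitFormula a ψ T B x := by
    intro B _
    rw [hσ']
    refine exists_congr fun x => ?_
    rw [h1', realizeAll_orbitFamily]
    have : (fun i : Fin n => Fin.append Fin.elim0 x (Fin.castLE hN i)) = x := by
      funext i
      have : Fin.castLE hN i = Fin.natAdd 0 i := Fin.ext (by simp)
      rw [this, Fin.append_right]
    rw [this]
  have hπB : ∀ (B : Type) [L.Structure B], π.Realize B Fin.elim0 ↔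
      ∀ x : Fin n → B, OrbitFormula a ψ T B x → Generates L x := by
    intro B _
    have key : ∀ x : Fin (n + 1) → B, φ₂.Realize B (Fin.append Fin.elim0 x) ↔
        (OrbitFormula a ψ T B (fun i => x i.castSucc) →
          ∃ t : L.Term (Fin n), t.realize (fun i => x i.castSucc) = x (Fin.last n)) := by
      intro x
      rw [h2', QFFamily.realizeSome_sum, realizeSome_orbitFamily, realizeSome_termFamily,
        imp_iff_not_or]
      have h3 : (fun i : Fin n => Fin.append Fin.elim0 x (Fin.castLE hN' i)) =
          fun i => x i.castSucc := by
        funext i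
        have : Fin.castLE hN' i = Fin.natAdd 0 i.castSucc := Fin.ext (by simp)
        rw [this, Fin.append_right]
      rw [h3, Fin.append_right]
    rw [hπ']
    simp only [key]
    constructor
    · intro h x hx
      rw [Generates.iff_terms]
      intro y
      simpa using h (Fin.snoc x y) (by simpa using hx)
    · intro h x hx
      exact Generates.iff_terms.1 (h _ hx) _
  refine ⟨.conj σ π, ⟨σ, π, hσ, hπ, rfl⟩, fun B _ _ => ⟨fun hB => ?_, fun ⟨g⟩ => ?_⟩⟩
  · obtain ⟨h3, h4⟩ := hB
    obtain ⟨x, hx⟩ := (hσB B).1 h3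
    -- The `Π₂` part makes `x` generate `B`; the first half of `OrbitFormula` says that `x` and `a`
    -- satisfy the same equations.
    exact exists_equiv_of_same_equations ha ((hπB B).1 h4 x hx) hx.1
  · have h3 : (InfFormula.conj σ π).Realize A Fin.elim0 :=
      ⟨(hσB A).2 ⟨a, hTa⟩, (hπB A).2 hTg⟩
    rw [← InfFormula.realize_equiv g] at h3
    rwa [Subsingleton.elim (g ∘ Fin.elim0) Fin.elim0] at h3

end Enumeration

end CompScott

theorem theorem1p4 (L : FirstOrder.Language) [L.IsAlgebraic]
    [Finite (Σ l, L.Functions l)] [Encodable (Σ l, L.Functions l)]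
    (K : (B : Type) → [L.Structure B] → Prop)
    (A : Set ℕ) [L.Structure A]
    (hcomp : IsComputableStructure L A)
    (hhopf : IsHopfian L A)
    (hfp : IsFinitelyPresentedIn K A) :
    (∃ φ : InfFormula L 0, IsComputableDSigma 2 φ ∧ IsScottSentence A φ) ↔
      DecidableWeakWhitehead L A :=
  ⟨fun ⟨_, hφ, hs⟩ => decidableWeakWhitehead_of_isScottSentence hcomp hhopf hfp hφ hs,
    exists_isScottSentence_of_decidableWeakWhitehead hcomp hhopf hfp⟩
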